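/- Let $k$ be an algebraically closed field and let $\Gamma$ be a finite acyclic quiver with vertex set $\Gamma_0$. For every $i\in\Gamma_0$ let $A_i$ be a basic finite-dimensional $k$-algebra with a chosen presentation $A_i\cong k\Sigma_i/\Omega_i$, where $\Sigma_i$ is a finite quiver and $\Omega_i$ is an admissible ideal of $k\Sigma_i$; write $\overline{\gamma}$ for the class in $A_i$ of a path $\gamma$ of $\Sigma_i$. Let $I$ be a set of relations on $\Gamma$ (each a $k$-linear combination $\sum_r \lambda_r\,\beta_{r1}\cdots\beta_{rm_r}$ of distinct paths with a common start and a common end) that generates an admissible ideal $(I)$ of $k\Gamma$; write $k\Gamma/I$ for $k\Gamma/(I)$. (An ideal $J$ of the path algebra of a quiver is admissible if $R^m\subseteq J\subseteq R^2$ for some $m\ge 2$, where $R$ is the ideal generated by the arrows.) The generalized path algebra $k(\Gamma,\mathcal A)$ is the $k$-vector space spanned by all sequences $a_1\beta_1a_2\cdots a_n\beta_na_{n+1}$ ($n\ge 0$), where $\beta_1\cdots\beta_n$ is a path of $\Gamma$ and each $a_r$ lies in the algebra at the corresponding vertex, modulo $k$-linearity in each $a_r$, with product given by $(a_1\beta_1\cdots\beta_na_{n+1})(b_1\gamma_1\cdots\gamma_mb_{m+1})=a_1\beta_1\cdots\beta_n(a_{n+1}b_1)\gamma_1\cdots\gamma_mb_{m+1}$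 if the first path ends where the second starts, and $0$ otherwise. Let $\Lambda=k(\Gamma,\mathcal A,I)$ be its quotient by the two-sided ideal generated by all elements $$\sum_r\lambda_r\,\beta_{r1}\overline{\gamma_{r1}}\beta_{r2}\cdots\overline{\gamma_{r(m_r-1)}}\beta_{rm_r},$$ where $\sum_r\lambda_r\,\beta_{r1}\cdots\beta_{rm_r}$ is a relation in $I$ and each $\gamma_{rs}$ is an arbitrary path in the quiver $\Sigma_v$, $v$ being the end vertex of $\beta_{rs}$. All modules are finitely generated right modules, $\operatorname{pd}$ is the projective dimension, and $\operatorname{gl.dim}$ is the supremum of the projective dimensions of all such modules. For $i\in\Gamma_0$ let $S_i$ be the simple $k\Gamma/I$-module over the vertex $i$. Suppose that for every vertex $i$ at which some (nonzero) relation in $I$ starts, $$\operatorname{pd}_{k\Gamma/I}S_i\ \ge\ \max\{\operatorname{pd}_{k\Gamma/I}S_j : j \text{ is a successor of } i\}+1,$$ where $j$ is a successor of $i$ if there is a path of positive length from $i$ to $j$. Then $\operatorname{gl.dim}A_j\le\operatorname{gl.dim}\Lambda$ for every $j\in\Gamma_0$, and $$\operatorname{gl.dim}\Lambda\ \le\ \max_{j\in\Gamma_0}\Big\{\operatorname{gl.dim}\frac{k\Gamma}{I},\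 \operatorname{gl.dim}A_j\Big\}.$$ -/

import Mathlib

universe u

noncomputable section

/-! ### Generalized path algebras -/

/-- The `𝒜`-paths from `i` to `j` over a quiver `V`, for a family `A` of algebras indexed by the
vertices: `nil a` is an element `a ∈ A i` (length zero), and `cons x β b` is the sequence
`x β b` obtained from the `𝒜`-path `x` by appending the arrow `β` and the element `b` of the
algebra at the end of `β`. -/
inductive APath {V : Type u} [Quiver.{u} V] (A : V → Type u) : V → V → Type u
  | nil {i : V} (a : A i) : APath A i i
  | cons {i j l : V} (x : APath A i j) (β : j ⟶ l) (b : A l) : APath A i l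

namespace APath

variable {k : Type u} [Field k] {V : Type u} [Quiver.{u} V] {A : V → Type u}
  [∀ i, Ring (A i)] [∀ i, Algebra k (A i)]

/-- `(a₁ β₁ ⋯ βₙ aₙ₊₁) · b = a₁ β₁ ⋯ βₙ (aₙ₊₁ b)`. -/
def rmul {i : V} : ∀ {j : V}, APath A i j → A j → APath A i j
  | _, nil a, b => nil (a * b)
  | _, cons x β a, b => cons x β (a * b)

/-- Concatenation
`(a₁ β₁ ⋯ βₙ aₙ₊₁)(b₁ γ₁ ⋯ γₘ bₘ₊₁) = a₁ β₁ ⋯ βₙ (aₙ₊₁ b₁) γ₁ ⋯ γₘ bₘ₊₁`. -/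
def mul {i j : V} (x : APath A i j) : ∀ {l : V}, APath A j l → APath A i l
  | _, nil b => x.rmul b
  | _, cons y β b => cons (mul x y) β b

/-- The ordinary path `β₁ ⋯ βₙ`, read as the `𝒜`-path `1 β₁ 1 ⋯ 1 βₙ 1`. -/
def ofPath (A : V → Type u) [∀ i, Ring (A i)] {i : V} : ∀ {j : V}, Quiver.Path i j → APath A i j
  | _, Quiver.Path.nil => nil 1
  | _, Quiver.Path.cons p β => cons (ofPath A p) β 1

/-- `IsAdd x y z`: the three `𝒜`-paths agree except in one slot, where `x` has the entry `a + b`,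
`y` the entry `a`, and `z` the entry `b`. -/
inductive IsAdd : ∀ {i j : V}, APath A i j → APath A i j → APath A i j → Prop
  | nil {i : V} (a b : A i) : IsAdd (nil (a + b)) (nil a) (nil b)
  | last {i j l : V} (x : APath A i j) (β : j ⟶ l) (a b : A l) :
      IsAdd (cons x β (a + b)) (cons x β a) (cons x β b)
  | cons {i j l : V} {x y z : APath A i j} (h : IsAdd x y z) (β : j ⟶ l) (c : A l) :
      IsAdd (cons x β c) (cons y β c) (cons z β c)

/-- `IsSMul t x y`: the two `𝒜`-paths agree except in one slot, where `x` has the entry `t • a`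
and `y` the entry `a`. -/
inductive IsSMul (t : k) : ∀ {i j : V}, APath A i j → APath A i j → Prop
  | nil {i : V} (a : A i) : IsSMul t (nil (t • a)) (nil a)
  | last {i j l : V} (x : APath A i j) (β : j ⟶ l) (a : A l) :
      IsSMul t (cons x β (t • a)) (cons x β a)
  | cons {i j l : V} {x y : APath A i j} (h : IsSMul t x y) (β : j ⟶ l) (c : A l) :
      IsSMul t (cons x β c) (cons y β c)

theorem rmul_one {i j : V} (x : APath A i j) : x.rmul 1 = x := by
  cases x <;> simp [rmul]

theorem rmul_mul {i j l : V} (x : APath A i j) (a : A j) (y : APath A j l) :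
    (x.rmul a).mul y = x.mul ((nil a).mul y) := by
  induction y with
  | nil b => cases x <;> simp [rmul, mul, mul_assoc]
  | cons y β b ih => simp [mul, ih]

theorem mul_rmul {i j l : V} (x : APath A i j) (y : APath A j l) (b : A l) :
    (x.mul y).rmul b = x.mul (y.rmul b) := by
  cases y with
  | nil a => cases x <;> simp [rmul, mul, mul_assoc]
  | cons y β a => simp [rmul, mul]

theorem mul_assoc' {i j l m : V} (x : APath A i j) (y : APath A j l) (z : APath A l m) :
    (x.mul y).mul z = x.mul (y.mul z) := by
  induction z with
  | nil b => simp [mul, mul_rmul]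
  | cons z β b ih => simp [mul, ih]

theorem mul_one' {i j : V} (x : APath A i j) : x.mul (nil 1) = x := by
  simp [mul, rmul_one]

theorem one_mul' {i j : V} (x : APath A i j) : (nil (1 : A i)).mul x = x := by
  induction x with
  | nil b => simp [rmul, mul]
  | cons x β b ih => simp [mul, ih]

theorem IsAdd.rmul {i j : V} {x y z : APath A i j} (h : IsAdd x y z) (b : A j) :
    IsAdd (x.rmul b) (y.rmul b) (z.rmul b) := by
  cases h with
  | nil a c => simpa [APath.rmul, add_mul] using IsAdd.nil (a * b) (c * b)
  | last x β a c => simpa [APath.rmul, add_mul] using IsAdd.last x β (a * b) (c * b)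
  | cons h β c => exact IsAdd.cons h β (c * b)

theorem IsAdd.mul_right {i j l : V} {x y z : APath A i j} (h : IsAdd x y z) (w : APath A j l) :
    IsAdd (x.mul w) (y.mul w) (z.mul w) := by
  induction w with
  | nil b => exact h.rmul b
  | cons w β b ih => exact IsAdd.cons ih β b

theorem IsAdd.mul_left {i j l : V} {x y z : APath A j l} (h : IsAdd x y z) (w : APath A i j) :
    IsAdd (w.mul x) (w.mul y) (w.mul z) := by
  induction h with
  | nil a c =>
    cases w with
    | nil b => simpa [APath.rmul, APath.mul, mul_add] using IsAdd.nil (b * a) (b * c)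
    | cons w β b =>
      simpa [APath.rmul, APath.mul, mul_add] using IsAdd.last w β (b * a) (b * c)
  | last x β a c => exact IsAdd.last (w.mul x) β a c
  | cons h β c ih => exact IsAdd.cons ih β c

theorem IsSMul.rmul {t : k} {i j : V} {x y : APath A i j} (h : IsSMul t x y) (b : A j) :
    IsSMul t (x.rmul b) (y.rmul b) := by
  cases h with
  | nil a => simpa [APath.rmul] using IsSMul.nil (t := t) (a * b)
  | last x β a => simpa [APath.rmul] using IsSMul.last (t := t) x β (a * b)
  | cons h β c => exact IsSMul.cons h β (c * b)

theorem IsSMul.mul_right {t : k} {i j l : V} {x y : APath A i j} (h : IsSMul t x y)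
    (w : APath A j l) : IsSMul t (x.mul w) (y.mul w) := by
  induction w with
  | nil b => exact h.rmul b
  | cons w β b ih => exact IsSMul.cons ih β b

theorem IsSMul.mul_left {t : k} {i j l : V} {x y : APath A j l} (h : IsSMul t x y)
    (w : APath A i j) : IsSMul t (w.mul x) (w.mul y) := by
  induction h with
  | nil a =>
    cases w with
    | nil b => simpa [APath.rmul, APath.mul] using IsSMul.nil (t := t) (b * a)
    | cons w β b =>
      simpa [APath.rmul, APath.mul] using IsSMul.last (t := t) w β (b * a)
  | last x β a => exact IsSMul.last (w.mul x) β a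
  | cons h β c ih => exact IsSMul.cons ih β c

end APath

section GPA

variable (k : Type u) [Field k] {V : Type u} [Quiver.{u} V] (A : V → Type u)
  [∀ i, Ring (A i)] [∀ i, Algebra k (A i)]

/-- The vector space `k[Γ, 𝒜]` with basis the set of all `𝒜`-paths. -/
abbrev FreeAPath : Type u := (Σ i j : V, APath A i j) →₀ k

/-- The basis vector of an `𝒜`-path. -/
abbrev FreeAPath.single {i j : V} (x : APath A i j) : FreeAPath k A :=
  Finsupp.single ⟨i, j, x⟩ 1

/-- The subspace of `k[Γ, 𝒜]` expressing that `𝒜`-paths are `k`-linear in each slot. -/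
def multilinearRel : Submodule k (FreeAPath k A) :=
  Submodule.span k
    ({v | ∃ (i j : V) (x y z : APath A i j), APath.IsAdd x y z ∧
        v = FreeAPath.single k A x - (FreeAPath.single k A y + FreeAPath.single k A z)} ∪
     {v | ∃ (i j : V) (t : k) (x y : APath A i j), APath.IsSMul t x y ∧
        v = FreeAPath.single k A x - t • FreeAPath.single k A y})

/-- The generalized path algebra `k(Γ, 𝒜)`, as a vector space. -/
def GPA : Type u := FreeAPath k A ⧸ multilinearRel k A

instance : AddCommGroup (GPA k A) :=
  inferInstanceAs (AddCommGroup (FreeAPath k A ⧸ multilinearRel k A))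

instance : Module k (GPA k A) :=
  inferInstanceAs (Module k (FreeAPath k A ⧸ multilinearRel k A))

namespace GPA

/-- The quotient map `k[Γ, 𝒜] → k(Γ, 𝒜)`. -/
def proj : FreeAPath k A →ₗ[k] GPA k A := (multilinearRel k A).mkQ

/-- The class of an `𝒜`-path in `k(Γ, 𝒜)`. -/
def of {i j : V} (x : APath A i j) : GPA k A := proj k A (FreeAPath.single k A x)

open Classical in
/-- The product in `k(Γ, 𝒜)` of two `𝒜`-paths: concatenation where possible, otherwise zero. -/
def mulPath (x y : Σ i j : V, APath A i j) : GPA k A :=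
  if h : y.1 = x.2.1 then of k A (x.2.2.mul (h ▸ y.2.2 : APath A x.2.1 y.2.1)) else 0

variable {A}

theorem mulPath_same {i j l : V} (x : APath A i j) (y : APath A j l) :
    mulPath k A ⟨i, j, x⟩ ⟨j, l, y⟩ = of k A (x.mul y) := by
  simp [mulPath]

theorem mulPath_ne {i j j' l : V} (h : j' ≠ j) (x : APath A i j) (y : APath A j' l) :
    mulPath k A ⟨i, j, x⟩ ⟨j', l, y⟩ = 0 := by
  simp [mulPath, h]

theorem of_add {i j : V} {x y z : APath A i j} (h : APath.IsAdd x y z) :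
    of k A x = of k A y + of k A z := by
  rw [← sub_eq_zero]
  simp only [of, ← map_add, ← map_sub]
  exact (Submodule.Quotient.mk_eq_zero _).2
    (Submodule.subset_span (Or.inl ⟨i, j, x, y, z, h, rfl⟩))

theorem of_smul {i j : V} {t : k} {x y : APath A i j} (h : APath.IsSMul t x y) :
    of k A x = t • of k A y := by
  rw [← sub_eq_zero]
  simp only [of, ← map_smul, ← map_sub]
  exact (Submodule.Quotient.mk_eq_zero _).2
    (Submodule.subset_span (Or.inr ⟨i, j, t, x, y, h, rfl⟩))

/-- To give a linear map on `k(Γ, 𝒜)` is to give its values on `𝒜`-paths, linearly in each slot. -/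
def lift {W : Type*} [AddCommGroup W] [Module k W] (f : ∀ i j : V, APath A i j → W)
    (hadd : ∀ i j (x y z : APath A i j), APath.IsAdd x y z → f i j x = f i j y + f i j z)
    (hsmul : ∀ i j (t : k) (x y : APath A i j), APath.IsSMul t x y → f i j x = t • f i j y) :
    GPA k A →ₗ[k] W :=
  (multilinearRel k A).liftQ
    (Finsupp.linearCombination k fun x : Σ i j : V, APath A i j => f x.1 x.2.1 x.2.2) <| by
    refine Submodule.span_le.2 ?_
    rintro v (⟨i, j, x, y, z, h, rfl⟩ | ⟨i, j, t, x, y, h, rfl⟩)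
    · simp [hadd i j x y z h]
    · simp [hsmul i j t x y h]

theorem lift_of {W : Type*} [AddCommGroup W] [Module k W] (f : ∀ i j : V, APath A i j → W)
    (hadd hsmul) {i j : V} (x : APath A i j) : lift k f hadd hsmul (of k A x) = f i j x := by
  have : lift k f hadd hsmul (of k A x) =
    Finsupp.linearCombination k (fun x : Σ i j : V, APath A i j => f x.1 x.2.1 x.2.2)
      (FreeAPath.single k A x) := rfl
  rw [this]; simp

theorem hom_ext {W : Type*} [AddCommGroup W] [Module k W] {f g : GPA k A →ₗ[k] W}
    (h : ∀ (i j : V) (x : APath A i j), f (of k A x) = g (of k A x)) : f = g := by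
  apply Submodule.linearMap_qext
  apply Finsupp.lhom_ext'
  rintro ⟨i, j, x⟩
  apply LinearMap.ext_ring
  exact h i j x

/-- The multiplication of `k(Γ, 𝒜)`: the bilinear extension of the product of `𝒜`-paths. -/
def mulL : GPA k A →ₗ[k] GPA k A →ₗ[k] GPA k A :=
  lift k
    (fun i j x => lift k (fun i' j' y => mulPath k A ⟨i, j, x⟩ ⟨i', j', y⟩)
      (by
        intro i' j' y y₁ y₂ h
        by_cases hj : i' = j
        · subst hj
          simp only [mulPath_same]
          exact of_add k (h.mul_left x)
        · simp [mulPath_ne k hj])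
      (by
        intro i' j' t y y₁ h
        by_cases hj : i' = j
        · subst hj
          simp only [mulPath_same]
          exact of_smul k (h.mul_left x)
        · simp [mulPath_ne k hj]))
    (by
      intro i j x x₁ x₂ h
      refine hom_ext k fun i' j' y => ?_
      simp only [LinearMap.add_apply, lift_of]
      by_cases hj : i' = j
      · subst hj
        simp only [mulPath_same]
        exact of_add k (h.mul_right y)
      · simp [mulPath_ne k hj])
    (by
      intro i j t x x₁ h
      refine hom_ext k fun i' j' y => ?_
      simp only [LinearMap.smul_apply, lift_of]
      by_cases hj : i' = j
      · subst hj
        simp only [mulPath_same]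
        exact of_smul k (h.mul_right y)
      · simp [mulPath_ne k hj])

instance : Mul (GPA k A) := ⟨fun v w => mulL k v w⟩

theorem mul_def (v w : GPA k A) : v * w = mulL k v w := rfl

theorem of_mul_of {i j l : V} (x : APath A i j) (y : APath A j l) :
    of k A x * of k A y = of k A (x.mul y) := by
  rw [mul_def, mulL, lift_of, lift_of, mulPath_same]

theorem of_mul_of_ne {i j j' l : V} (h : j' ≠ j) (x : APath A i j) (y : APath A j' l) :
    of k A x * of k A y = 0 := by
  rw [mul_def, mulL, lift_of, lift_of, mulPath_ne k h]

theorem mul_assoc_aux (u v w : GPA k A) : mulL k (mulL k u v) w = mulL k u (mulL k v w) := by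
  suffices h : (mulL k (A := A)).compr₂ (mulL k) =
      ((LinearMap.lcomp k _ (mulL k (A := A))).comp
        ((LinearMap.llcomp k (GPA k A) (GPA k A) (GPA k A)).comp (mulL k))) from
    LinearMap.congr_fun (LinearMap.congr_fun (LinearMap.congr_fun h u) v) w
  refine hom_ext k fun i j x => hom_ext k fun i' j' y => hom_ext k fun i'' j'' z => ?_
  change of k A x * of k A y * of k A z = of k A x * (of k A y * of k A z)
  by_cases h : i' = j
  · subst h
    by_cases h' : i'' = j'
    · subst h'
      simp only [of_mul_of, APath.mul_assoc']
    · rw [of_mul_of, of_mul_of_ne k h', of_mul_of_ne k h', mul_def, map_zero]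
  · rw [of_mul_of_ne k h]
    by_cases h' : i'' = j'
    · subst h'
      rw [of_mul_of, of_mul_of_ne k h, mul_def, map_zero, LinearMap.zero_apply]
    · rw [of_mul_of_ne k h', mul_def, mul_def, map_zero, map_zero, LinearMap.zero_apply]

variable [Fintype V]

/-- The identity `∑ i, 1_{A i}` of `k(Γ, 𝒜)`. -/
instance : One (GPA k A) := ⟨∑ i : V, of k A (APath.nil (1 : A i))⟩

theorem one_def : (1 : GPA k A) = ∑ i : V, of k A (APath.nil (1 : A i)) := rfl

theorem one_mul_aux (v : GPA k A) : mulL k 1 v = v := by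
  suffices h : mulL k (1 : GPA k A) = LinearMap.id from LinearMap.congr_fun h v
  refine hom_ext k fun i j x => ?_
  rw [one_def, map_sum, LinearMap.sum_apply, Finset.sum_eq_single i]
  · rw [← mul_def, of_mul_of, APath.one_mul', LinearMap.id_apply]
  · intro l _ hl
    rw [← mul_def, of_mul_of_ne k hl.symm]
  · intro h
    exact (h (Finset.mem_univ _)).elim

theorem mul_one_aux (v : GPA k A) : mulL k v 1 = v := by
  suffices h : (mulL k (A := A)).flip 1 = LinearMap.id from LinearMap.congr_fun h v
  refine hom_ext k fun i j x => ?_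
  rw [LinearMap.flip_apply, one_def, map_sum, Finset.sum_eq_single j]
  · rw [← mul_def, of_mul_of, APath.mul_one', LinearMap.id_apply]
  · intro l _ hl
    rw [← mul_def, of_mul_of_ne k hl]
  · intro h
    exact (h (Finset.mem_univ _)).elim

instance : Ring (GPA k A) where
  __ := (inferInstance : AddCommGroup (GPA k A))
  __ := (inferInstance : Mul (GPA k A))
  __ := (inferInstance : One (GPA k A))
  mul_assoc := mul_assoc_aux k
  one_mul := one_mul_aux k
  mul_one := mul_one_aux k
  left_distrib u v w := map_add (mulL k u) v w
  right_distrib u v w := by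
    change mulL k (u + v) w = mulL k u w + mulL k v w
    rw [map_add, LinearMap.add_apply]
  zero_mul u := by
    change mulL k 0 u = 0
    rw [map_zero, LinearMap.zero_apply]
  mul_zero u := map_zero (mulL k u)

instance : Algebra k (GPA k A) :=
  Algebra.ofModule
    (fun t u v => by
      change mulL k (t • u) v = t • mulL k u v
      rw [map_smul, LinearMap.smul_apply])
    (fun t u v => map_smul (mulL k u) t v)

end GPA
end GPA

/-! ### Path algebras, admissible ideals, presentations by bound quivers -/

section PathAlgebra

variable (k : Type u) [Field k] (V : Type u) [Quiver.{u} V]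

/-- The ordinary path algebra `kΓ`: the generalized path algebra with `A i = k` at every vertex. -/
abbrev PathAlgebra : Type u := GPA k (fun _ : V => k)

variable {V}

/-- A path, as an element of the path algebra. -/
def PathAlgebra.ofPath {i j : V} (p : Quiver.Path i j) : PathAlgebra k V :=
  GPA.of k _ (APath.ofPath (fun _ : V => k) p)

variable (V) [Fintype V]

/-- The `m`-th power of the arrow ideal of the path algebra: the two-sided ideal generated by all
paths of length `m`. -/
def arrowIdealPow (m : ℕ) : TwoSidedIdeal (PathAlgebra k V) :=
  TwoSidedIdeal.span {x | ∃ (i j : V) (p : Quiver.Path i j), p.length = m ∧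
    x = PathAlgebra.ofPath k p}

variable {k V}

/-- An ideal of the path algebra is admissible if it lies between some power `m ≥ 2` of the arrow
ideal and the square of the arrow ideal. -/
def IsAdmissible (J : TwoSidedIdeal (PathAlgebra k V)) : Prop :=
  (∃ m : ℕ, 2 ≤ m ∧ arrowIdealPow k V m ≤ J) ∧ J ≤ arrowIdealPow k V 2

end PathAlgebra

/-- A presentation of the `k`-algebra `A` by a bound quiver: a finite quiver `Σ` and a surjection
`kΣ → A` whose kernel `Ω` is an admissible ideal, so that `A ≅ kΣ/Ω`. -/
structure BoundQuiverPresentation (k : Type u) [Field k] (A : Type u) [Ring A] [Algebra k A] where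
  /-- The vertices of `Σ`. -/
  Vertex : Type u
  [fintypeVertex : Fintype Vertex]
  [quiver : Quiver.{u} Vertex]
  [finiteArrows : ∀ a b : Vertex, Finite (a ⟶ b)]
  /-- The surjection `kΣ → A`. -/
  toAlgebra : PathAlgebra k Vertex →ₐ[k] A
  surjective : Function.Surjective toAlgebra
  admissible : IsAdmissible (TwoSidedIdeal.ker toAlgebra)

namespace BoundQuiverPresentation

attribute [instance] fintypeVertex quiver finiteArrows

variable {k : Type u} [Field k] {A : Type u} [Ring A] [Algebra k A]

/-- The class `γ̄` in `A` of a path `γ` of the presenting quiver. -/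
def path (P : BoundQuiverPresentation k A) {a b : P.Vertex} (γ : Quiver.Path a b) : A :=
  P.toAlgebra (PathAlgebra.ofPath k γ)

end BoundQuiverPresentation

/-! ### Generalized bound path algebras -/

section GBPA

variable (k : Type u) [Field k] {V : Type u} [Fintype V] [Quiver.{u} V]

/-- The two-sided ideal `(I)` of `kΓ` generated by a set of relations; `I i j` is the set of
relations from `i` to `j`, each one a `k`-linear combination of (distinct) paths from `i` to `j`. -/
def relationIdeal (I : ∀ i j : V, Set (Quiver.Path i j →₀ k)) : TwoSidedIdeal (PathAlgebra k V) :=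
  TwoSidedIdeal.span {x | ∃ (i j : V), ∃ ρ ∈ I i j,
    x = ρ.sum fun p t => t • PathAlgebra.ofPath k p}

/-- The bound path algebra `kΓ/I`. -/
abbrev BoundPathAlgebra (I : ∀ i j : V, Set (Quiver.Path i j →₀ k)) : Type u :=
  PathAlgebra k V ⧸ (relationIdeal k I).asIdeal

variable {k} {A : V → Type u} [∀ i, Ring (A i)] [∀ i, Algebra k (A i)]

/-- `Inserts P p x` holds if `p = β₁ ⋯ βₘ` and `x` is an `𝒜`-path `β₁ γ̄₁ β₂ γ̄₂ ⋯ γ̄ₘ₋₁ βₘ`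
(with the entry `1` at both ends), where each `γᵣ` is a path in the quiver presenting the algebra
at the end vertex of `βᵣ`. -/
inductive Inserts (P : ∀ i, BoundQuiverPresentation k (A i)) :
    ∀ {i j : V}, Quiver.Path i j → APath A i j → Prop
  | nil (i : V) : Inserts P (Quiver.Path.nil : Quiver.Path i i) (APath.nil 1)
  | arrow {i j : V} (β : i ⟶ j) :
      Inserts P (Quiver.Path.nil.cons β) ((APath.nil 1).cons β 1)
  | step {i j l m : V} {p : Quiver.Path i j} {β : j ⟶ l} {x : APath A i j}
      (h : Inserts P (p.cons β) (x.cons β 1)) {a b : (P l).Vertex} (γ : Quiver.Path a b)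
      (β' : l ⟶ m) : Inserts P ((p.cons β).cons β') ((x.cons β ((P l).path γ)).cons β' 1)

/-- The ideal `(𝒜(I))` of `k(Γ, 𝒜)`, generated by all elements obtained from a relation
`∑ₚ tₚ p` in `I` by inserting, independently into each of the paths `p` that occur in it, classes
of paths of the presenting quivers at the inner vertices of `p`. -/
def gbpIdeal (P : ∀ i, BoundQuiverPresentation k (A i))
    (I : ∀ i j : V, Set (Quiver.Path i j →₀ k)) : TwoSidedIdeal (GPA k A) :=
  TwoSidedIdeal.span {v | ∃ (i j : V), ∃ ρ ∈ I i j, ∃ x : Quiver.Path i j → APath A i j,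
    (∀ p ∈ ρ.support, Inserts P p (x p)) ∧ v = ρ.sum fun p t => t • GPA.of k A (x p)}

/-- The generalized bound path algebra `k(Γ, 𝒜, I) = k(Γ, 𝒜)/(𝒜(I))`. -/
abbrev GBPAlgebra (P : ∀ i, BoundQuiverPresentation k (A i))
    (I : ∀ i j : V, Set (Quiver.Path i j →₀ k)) : Type u :=
  GPA k A ⧸ (gbpIdeal P I).asIdeal

end GBPA

/-! ### Homological dimensions, for right modules -/

section Homological

open CategoryTheory

/-- The projective dimension of a right `R`-module; it is `⊥` for the zero module. -/
def rightProjDim (R : Type u) [Ring R] (M : Type u) [AddCommGroup M] [Module Rᵐᵒᵖ M] :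
    WithBot ℕ∞ :=
  projectiveDimension (ModuleCat.of Rᵐᵒᵖ M)

/-- The global dimension of `R`: the supremum of the projective dimensions of the finitely
generated right `R`-modules. -/
def globalDim (R : Type u) [Ring R] : WithBot ℕ∞ :=
  ⨆ (M : ModuleCat.{u} Rᵐᵒᵖ) (_ : Module.Finite Rᵐᵒᵖ M), projectiveDimension M

variable {k : Type u} [Field k] {V : Type u} [Fintype V] [Quiver.{u} V]

/-- The class of a path in `kΓ/I`. -/
def BoundPathAlgebra.ofPath (I : ∀ i j : V, Set (Quiver.Path i j →₀ k)) {i j : V}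
    (p : Quiver.Path i j) : BoundPathAlgebra k I :=
  Ideal.Quotient.mk _ (PathAlgebra.ofPath k p)

/-- The simple right `kΓ/I`-module `S_j` over the vertex `j`: the quotient of `kΓ/I` by the right
ideal generated by all arrows and all the trivial paths at the vertices other than `j`. -/
abbrev VertexSimple (I : ∀ i j : V, Set (Quiver.Path i j →₀ k)) (j : V) : Type u :=
  BoundPathAlgebra k I ⧸ Submodule.span (BoundPathAlgebra k I)ᵐᵒᵖ
    ({x | ∃ (i l : V) (β : i ⟶ l), x = BoundPathAlgebra.ofPath I β.toPath} ∪
     {x | ∃ i : V, i ≠ j ∧ x = BoundPathAlgebra.ofPath I (Quiver.Path.nil : Quiver.Path i i)})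

/-- The condition on `kΓ/I`: whenever some (nonzero) relation of `I` starts at the vertex `i`, the
inequality `pd S_i ≥ pd S_j + 1` holds for every successor `j` of `i`, that is, for every vertex
`j` at the end of a path of positive length which starts at `i`. -/
def RelationStartCondition (I : ∀ i j : V, Set (Quiver.Path i j →₀ k)) : Prop :=
  ∀ i : V, (∃ l : V, ∃ ρ ∈ I i l, ρ ≠ 0) →
    ∀ (j : V) (p : Quiver.Path i j), 0 < p.length →
      rightProjDim (BoundPathAlgebra k I) (VertexSimple I j) + 1 ≤
        rightProjDim (BoundPathAlgebra k I) (VertexSimple I i)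

end Homological

end

/-! Write `Λ` for a quotient `GPQ J` of a generalized path algebra, `e_i` for the identity of `A i`
inside `Λ`, and `N_i` (`arrowModule`) for the right ideal generated by the arrows starting at `i`.
Both `k(Γ, 𝒜, I)` and `kΓ/I` have this form. All that is needed of `J` is `GPA.GeneratedBy`: its
generators come from relations in `I` and have the entry `1` before the first arrow and after the
last one. The first and last entries of a path can therefore be split off freely. Right modules are
treated as left modules over opposite rings.

First entries: `e_i Λ` is an extension of `A i` by `N_i ⊗ A i`, tensor products being over `k`. For
an `A i`-module `X` this gives an exact sequence `0 → N_i ⊗ X → X ⊗_{A i} e_i Λ → X → 0`. Its middle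
term is exact in `X` and takes finitely generated projectives to projectives, while `N_i ⊗ X` is a
finite power of `N_i`. Hence `pd_Λ X ≤ max (pd_{A i} X) (pd N_i + 1)` (`GPQ.pdLT_infl`).

Last entries: `Λ e_j` and `N_i e_j` are projective over `A j`. So `M ↦ M e_j` is exact and does not
raise projective dimension; as it recovers an `A j`-module from its inflation to `Λ`, `gl.dim A j ≤
gl.dim Λ` (`GPQ.globalDim_vertex_le`).

For the upper bound, acyclicity filters every `Λ`-module `M` by the inflations of the corners `M
e_j` (`PdLT.of_corners`), so it remains to see that `pd N_i + 1 ≤ pd S_i` (`GPQ.pdLT_arrowModule`).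
This goes by induction over the successors of `i`. If no relation starts at `i`, then `N_i` is
projective, and it is zero unless an arrow starts at `i`, in which case `S_i` is not projective. If
a relation starts at `i`, then `N_i` is filtered by inflations of the modules `N_i e_j`, for `j` a
successor of `i`. These are projective over `A j`, so their projective dimension over `Λ` is at most
`max 0 (pd N_j + 1) ≤ pd S_j`, and the hypothesis on `I` gives `pd S_j + 1 ≤ pd S_i`. -/

section

/-! ### Projective dimension bounds, inflation, and tensoring with a vector space -/

open CategoryTheory TensorProduct

/-- `PdLT R M n`: the projective dimension of the `R`-module `M` is less than `n`. -/
abbrev PdLT (R : Type u) [Ring R] (M : Type u) [AddCommGroup M] [Module R M] (n : ℕ) : Prop :=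
  HasProjectiveDimensionLT (ModuleCat.of R M) n

namespace PdLT

variable {R : Type u} [Ring R] {M N L : Type u} [AddCommGroup M] [Module R M]
  [AddCommGroup N] [Module R N] [AddCommGroup L] [Module R L] {n m : ℕ}

theorem zero_iff : PdLT R M 0 ↔ Subsingleton M := by
  rw [PdLT, hasProjectiveDimensionLT_zero_iff_isZero, ModuleCat.isZero_iff_subsingleton]

theorem one_iff : PdLT R M 1 ↔ Module.Projective R M := by
  rw [PdLT, ← projective_iff_hasProjectiveDimensionLT_one, ← IsProjective.iff_projective]

theorem mono (h : PdLT R M n) (hnm : n ≤ m) : PdLT R M m :=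
  have : HasProjectiveDimensionLT (ModuleCat.of R M) n := h
  hasProjectiveDimensionLT_of_ge _ n m hnm

theorem of_subsingleton [Subsingleton M] : PdLT R M n :=
  (zero_iff.2 inferInstance).mono (Nat.zero_le n)

theorem of_projective [Module.Projective R M] : PdLT R M (n + 1) :=
  (one_iff.2 inferInstance).mono (Nat.le_add_left 1 n)

theorem of_retract (f : M →ₗ[R] N) (g : N →ₗ[R] M) (h : g ∘ₗ f = LinearMap.id)
    (hN : PdLT R N n) : PdLT R M n :=
  have : HasProjectiveDimensionLT (ModuleCat.of R N) n := hN
  Retract.hasProjectiveDimensionLT (X := ModuleCat.of R M) (Y := ModuleCat.of R N)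
    ⟨ModuleCat.ofHom f, ModuleCat.ofHom g, by rw [← ModuleCat.ofHom_comp, h]; rfl⟩ n

theorem of_equiv (e : M ≃ₗ[R] N) (hN : PdLT R N n) : PdLT R M n :=
  of_retract e.toLinearMap e.symm.toLinearMap (by ext; simp) hN

theorem shortExact (f : M →ₗ[R] N) (g : N →ₗ[R] L) (hf : Function.Injective f)
    (hg : Function.Surjective g) (hfg : Function.Exact f g) :
    (ShortComplex.mk (ModuleCat.ofHom f) (ModuleCat.ofHom g)
      (by rw [← ModuleCat.ofHom_comp, hfg.linearMap_comp_eq_zero]; rfl)).ShortExact where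
  exact := (ShortComplex.ShortExact.moduleCat_exact_iff_function_exact _).2 hfg
  mono_f := (ModuleCat.mono_iff_injective _).2 hf
  epi_g := (ModuleCat.epi_iff_surjective _).2 hg

theorem middle (f : M →ₗ[R] N) (g : N →ₗ[R] L) (hf : Function.Injective f)
    (hg : Function.Surjective g) (hfg : Function.Exact f g)
    (h₁ : PdLT R M n) (h₃ : PdLT R L n) : PdLT R N n :=
  (shortExact f g hf hg hfg).hasProjectiveDimensionLT_X₂ n h₁ h₃

theorem right (f : M →ₗ[R] N) (g : N →ₗ[R] L) (hf : Function.Injective f)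
    (hg : Function.Surjective g) (hfg : Function.Exact f g)
    (h₁ : PdLT R M n) (h₂ : PdLT R N (n + 1)) : PdLT R L (n + 1) :=
  (shortExact f g hf hg hfg).hasProjectiveDimensionLT_X₃ n h₁ h₂

theorem left (f : M →ₗ[R] N) (g : N →ₗ[R] L) (hf : Function.Injective f)
    (hg : Function.Surjective g) (hfg : Function.Exact f g)
    (h₂ : PdLT R N n) (h₃ : PdLT R L (n + 1)) : PdLT R M n :=
  (shortExact f g hf hg hfg).hasProjectiveDimensionLT_X₁ n h₂ h₃

theorem pi (hM : PdLT R M n) (r : ℕ) : PdLT R (Fin r → M) n := by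
  induction r with
  | zero => exact of_subsingleton
  | succ r ih =>
    refine middle (LinearMap.single R (fun _ : Fin (r + 1) => M) 0)
      (LinearMap.funLeft R M Fin.succ) (Pi.single_injective (M := fun _ => M) 0)
      (LinearMap.funLeft_surjective_of_injective R M _ (Fin.succ_injective r)) (fun x => ?_) hM ih
    constructor
    · intro hx
      refine ⟨x 0, funext fun i => ?_⟩
      induction i using Fin.cases with
      | zero => simp
      | succ i => simpa using (congrFun hx i).symm
    · rintro ⟨y, rfl⟩
      ext i
      simp [LinearMap.funLeft_apply]

end PdLT

/-- The `R`-module obtained from an `S`-module by restriction of scalars along `f : R →+* S`. -/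
def Infl {R S : Type u} [Ring R] [Ring S] (_ : R →+* S) (X : Type u) : Type u := X

namespace Infl

variable {R S : Type u} [Ring R] [Ring S] (f : R →+* S) {X Y : Type u} [AddCommGroup X]
  [Module S X] [AddCommGroup Y] [Module S Y]

instance : AddCommGroup (Infl f X) := inferInstanceAs (AddCommGroup X)

instance : Module R (Infl f X) := Module.compHom X f

/-- The identity map of `X`, as an additive equivalence onto its inflation. -/
def mk : X ≃+ Infl f X := AddEquiv.refl X

theorem smul_mk (r : R) (x : X) : r • mk f x = mk f (f r • x) := rfl

instance [Subsingleton X] : Subsingleton (Infl f X) := inferInstanceAs (Subsingleton X)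

/-- Inflation is functorial. -/
def map (g : X →ₗ[S] Y) : Infl f X →ₗ[R] Infl f Y where
  toFun x := mk f (g ((mk f).symm x))
  map_add' x y := map_add g ((mk f).symm x) ((mk f).symm y)
  map_smul' r x := map_smul g (f r) ((mk f).symm x)

theorem pdLT_equiv (e : X ≃ₗ[S] Y) {n : ℕ} (h : PdLT R (Infl f Y) n) : PdLT R (Infl f X) n :=
  PdLT.of_retract (map f e.toLinearMap) (map f e.symm.toLinearMap)
    (LinearMap.ext fun x => e.symm_apply_apply ((mk f).symm x)) h

theorem finite (hf : Function.Surjective f) [Module.Finite S X] : Module.Finite R (Infl f X) := by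
  obtain ⟨s, hs⟩ := Module.Finite.fg_top (R := S) (M := X)
  refine ⟨⟨s.map (mk f).toEquiv.toEmbedding, top_le_iff.1 ?_⟩⟩
  rintro y -
  obtain ⟨y, rfl⟩ := (mk f).surjective y
  have hy : y ∈ Submodule.span S (s : Set X) := hs ▸ Submodule.mem_top
  induction hy using Submodule.span_induction with
  | mem x hx => exact Submodule.subset_span (by simpa using hx)
  | zero => simp
  | add x y _ _ hx hy => simpa using add_mem hx hy
  | smul a x _ hx =>
    obtain ⟨r, rfl⟩ := hf a
    rw [← smul_mk]
    exact Submodule.smul_mem _ r hx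

end Infl

section TensorPower

variable {k : Type u} [Field k] {R : Type u} [Ring R] {N X : Type u} [AddCommGroup N]
  [Module R N] [Module k N] [SMulCommClass k R N] [AddCommGroup X] [Module k X]

/-- A basis of the finite-dimensional space `X` makes `N ⊗ X` a retract of a finite power of `N`:
`F` takes coordinates and `G` recombines them. -/
theorem PdLT.tensor [Module.Finite k X] {n : ℕ} (hN : PdLT R N n) : PdLT R (N ⊗[k] X) n := by
  let b := Module.finBasis k X
  let F : N ⊗[k] X →ₗ[R] (Fin (Module.finrank k X) → N) := LinearMap.pi fun i =>
    { toFun := TensorProduct.lift (LinearMap.flip ((LinearMap.lsmul k N).comp (b.coord i)))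
      map_add' := map_add _
      map_smul' := fun r t => by
        induction t using TensorProduct.induction_on with
        | zero => simp
        | tmul x y => simp [TensorProduct.smul_tmul', smul_comm]
        | add x y hx hy => simp only [smul_add, map_add, hx, hy] }
  let G : (Fin (Module.finrank k X) → N) →ₗ[R] N ⊗[k] X := LinearMap.lsum R (fun _ => N) ℕ fun i =>
    { toFun := fun y => y ⊗ₜ b i
      map_add' := fun x y => TensorProduct.add_tmul _ _ _
      map_smul' := fun r x => rfl }
  refine PdLT.of_retract F G (LinearMap.ext fun t => ?_) (hN.pi _)
  induction t using TensorProduct.induction_on with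
  | zero => simp
  | add x y hx hy => rw [map_add, hx, hy, map_add]
  | tmul x y =>
    have h : G (F (x ⊗ₜ y)) = ∑ i, (b.repr y i • x) ⊗ₜ[k] b i := by
      simp only [G, LinearMap.lsum_apply, LinearMap.sum_apply]
      rfl
    rw [LinearMap.comp_apply, h, LinearMap.id_apply]
    simp only [TensorProduct.smul_tmul, ← TensorProduct.tmul_sum, b.sum_repr]

end TensorPower

end

/-! ### The functor `X ↦ X ⊗_B eR` as a twisted extension of `X` by `N ⊗ X` -/

section

open CategoryTheory TensorProduct

/-- The data which exhibit, for algebras `R` and `B` over `k`, a projective `R`-module as an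
extension of the inflation of `B` along `π : R → B` by the module `N ⊗ B`. -/
structure ConeData (k R B N : Type u) [Field k] [Ring R] [Algebra k R] [Ring B] [Algebra k B]
    [AddCommGroup N] [Module R N] [Module k N] [IsScalarTower k R N] where
  π : R →ₐ[k] B
  D : R →ₗ[k] N ⊗[k] B
  ι : B →ₗ[k] R
  ν : N →ₗ[R] R
  D_mul (r s : R) : D (r * s) = r • D s + LinearMap.lTensor N (LinearMap.mulRight k (π s)) (D r)
  π_ι (b : B) : π (ι b) = b
  D_ι (b : B) : D (ι b) = 0
  π_ν (n : N) : π (ν n) = 0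
  D_ν (n : N) : D (ν n) = n ⊗ₜ 1
  mul_ι (r : R) (b : B) : r * ι b = ι (π r * b) +
    TensorProduct.lift ((LinearMap.mul k R).compl₁₂ (ν.restrictScalars k) ι)
      (LinearMap.lTensor N (LinearMap.mulRight k b) (D r))

/-- The extension of the inflation of `X` by `N ⊗ X` determined by a cone datum. -/
def Cone {k R B N : Type u} [Field k] [Ring R] [Algebra k R] [Ring B] [Algebra k B]
    [AddCommGroup N] [Module R N] [Module k N] [IsScalarTower k R N] (_ : ConeData k R B N)
    (X : Type u) [AddCommGroup X] [Module k X] : Type u := X × N ⊗[k] X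

namespace ConeData

variable {k R B N : Type u} [Field k] [Ring R] [Algebra k R] [Ring B] [Algebra k B]
  [AddCommGroup N] [Module R N] [Module k N] [IsScalarTower k R N] (c : ConeData k R B N)

instance (X : Type u) [AddCommGroup X] [Module k X] : AddCommGroup (Cone c X) :=
  inferInstanceAs (AddCommGroup (X × N ⊗[k] X))

variable (X : Type u) [AddCommGroup X] [Module k X] [Module B X] [IsScalarTower k B X]
  {Y Z : Type u} [AddCommGroup Y] [Module k Y] [Module B Y] [IsScalarTower k B Y]
  [AddCommGroup Z] [Module k Z] [Module B Z] [IsScalarTower k B Z]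

/-- The map `D` evaluated on elements of `X`. -/
def act : X →ₗ[k] R →ₗ[k] N ⊗[k] X :=
  LinearMap.mk₂ k (fun x r => LinearMap.lTensor N
      ((LinearMap.toSpanSingleton B X x).restrictScalars k) (c.D r))
    (fun x y r => by
      rw [← LinearMap.add_apply, ← LinearMap.lTensor_add]
      congr 2; ext; simp)
    (fun t x r => by
      rw [← LinearMap.smul_apply, ← LinearMap.lTensor_smul]
      congr 2; ext b; exact smul_comm b t x)
    (fun x r s => by simp)
    (fun t x r => by simp)

variable {X}

theorem act_apply (x : X) (r : R) : c.act X x r =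
    LinearMap.lTensor N ((LinearMap.toSpanSingleton B X x).restrictScalars k) (c.D r) := rfl

theorem smul_lTensor (f : X →ₗ[k] Y) (r : R) (t : N ⊗[k] X) :
    LinearMap.lTensor N f (r • t) = r • LinearMap.lTensor N f t := by
  induction t using TensorProduct.induction_on with
  | zero => simp
  | tmul x y => simp [TensorProduct.smul_tmul']
  | add x y hx hy => simp only [smul_add, map_add, hx, hy]

/-- The field `D_mul` makes `D` a derivation, with `R` acting on one side through `π`. Evaluated at
`x` it becomes the cocycle identity that makes the twisted action on `X × N ⊗ X` associative. -/
theorem act_mul (x : X) (r s : R) :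
    c.act X x (r * s) = r • c.act X x s + c.act X (c.π s • x) r := by
  rw [act_apply, D_mul, map_add, smul_lTensor, act_apply, act_apply,
    ← LinearMap.lTensor_comp_apply]
  congr 3
  ext b
  simp [mul_smul]

theorem D_one : c.D 1 = 0 := by
  have h := c.D_mul 1 1
  rw [map_one c.π, mul_one, one_smul, LinearMap.mulRight_one, LinearMap.lTensor_id,
    LinearMap.id_apply] at h
  simpa using h

theorem act_one (x : X) : c.act X x 1 = 0 := by
  rw [act_apply, D_one, map_zero]

instance : Module R (Cone c X) where
  smul r p := ((c.π r • p.1, c.act X p.1 r + r • p.2) : X × N ⊗[k] X)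
  one_smul p := Prod.ext (by change c.π 1 • p.1 = p.1; simp)
    (by change c.act X p.1 1 + (1 : R) • p.2 = p.2; rw [act_one, zero_add, one_smul])
  mul_smul r s p := Prod.ext (by change c.π (r * s) • p.1 = c.π r • c.π s • p.1; simp [mul_smul])
    (by
      change c.act X p.1 (r * s) + (r * s) • p.2 =
        c.act X (c.π s • p.1) r + r • (c.act X p.1 s + s • p.2)
      rw [act_mul, mul_smul, smul_add]; abel)
  smul_zero r := Prod.ext (smul_zero (c.π r))
    (by change c.act X 0 r + r • (0 : N ⊗[k] X) = 0; simp)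
  smul_add r p q := Prod.ext (smul_add (c.π r) p.1 q.1)
    (by
      change c.act X (p.1 + q.1) r + r • (p.2 + q.2) =
        (c.act X p.1 r + r • p.2) + (c.act X q.1 r + r • q.2)
      rw [map_add, LinearMap.add_apply, smul_add]; abel)
  add_smul r s p := Prod.ext (by change c.π (r + s) • p.1 = _; rw [map_add, add_smul]; rfl)
    (by
      change c.act X p.1 (r + s) + (r + s) • p.2 =
        (c.act X p.1 r + r • p.2) + (c.act X p.1 s + s • p.2)
      rw [map_add, add_smul]; abel)
  zero_smul p := Prod.ext (by change c.π 0 • p.1 = 0; simp)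
    (by change c.act X p.1 0 + (0 : R) • p.2 = 0; simp)

theorem act_map (f : X →ₗ[B] Y) (x : X) (r : R) :
    LinearMap.lTensor N (f.restrictScalars k) (c.act X x r) = c.act Y (f x) r := by
  rw [act_apply, act_apply, ← LinearMap.comp_apply (LinearMap.lTensor N _),
    ← LinearMap.lTensor_comp]
  congr 2
  ext b
  simp

/-- The cone is functorial. -/
def map (f : X →ₗ[B] Y) : Cone c X →ₗ[R] Cone c Y where
  toFun p := (f p.1, LinearMap.lTensor N (f.restrictScalars k) p.2)
  map_add' p q := Prod.ext (map_add f p.1 q.1) (map_add (LinearMap.lTensor N _) p.2 q.2)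
  map_smul' r p := Prod.ext (map_smul f (c.π r) p.1) (by
    change LinearMap.lTensor N (f.restrictScalars k) (c.act X p.1 r + r • p.2) =
      c.act Y (f p.1) r + r • LinearMap.lTensor N (f.restrictScalars k) p.2
    rw [map_add, act_map, smul_lTensor])

/-- Without the twist the cone is `X × N ⊗ X`, and exactness does not depend on the action;
tensoring over a field preserves it. -/
theorem map_exact (f : X →ₗ[B] Y) (g : Y →ₗ[B] Z) (hg : Function.Surjective g)
    (hfg : Function.Exact f g) : Function.Exact (c.map f) (c.map g) := by
  have h := lTensor_exact N (f := f.restrictScalars k) (g := g.restrictScalars k) hfg hg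
  intro p
  constructor
  · intro hp
    obtain ⟨x, hx⟩ := (hfg p.1).1 (congrArg Prod.fst hp)
    obtain ⟨t, ht⟩ := (h p.2).1 (congrArg Prod.snd hp)
    exact ⟨(x, t), Prod.ext hx ht⟩
  · rintro ⟨q, rfl⟩
    exact Prod.ext ((hfg _).2 ⟨q.1, rfl⟩) ((h _).2 ⟨q.2, rfl⟩)

theorem map_surjective (f : X →ₗ[B] Y) (hf : Function.Surjective f) :
    Function.Surjective (c.map f) := by
  intro p
  obtain ⟨x, hx⟩ := hf p.1
  obtain ⟨t, ht⟩ := LinearMap.lTensor_surjective N (g := f.restrictScalars k) hf p.2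
  exact ⟨(x, t), Prod.ext hx ht⟩

theorem map_injective (f : X →ₗ[B] Y) (hf : Function.Injective f) :
    Function.Injective (c.map f) := by
  intro p q hpq
  refine Prod.ext (hf (congrArg Prod.fst hpq)) ?_
  exact Module.Flat.lTensor_preserves_injective_linearMap (M := N) (f.restrictScalars k) hf
    (congrArg Prod.snd hpq)

/-- The section of the projection from `R` onto the cone of `B`. -/
def sec : Cone c B →ₗ[R] R where
  toFun p := c.ι p.1 +
    TensorProduct.lift ((LinearMap.mul k R).compl₁₂ (c.ν.restrictScalars k) c.ι) p.2
  map_add' p q := by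
    change c.ι (p.1 + q.1) + TensorProduct.lift _ (p.2 + q.2) = _
    rw [map_add, map_add]; abel
  map_smul' r p := by
    change c.ι (c.π r * p.1) + TensorProduct.lift _ (c.act B p.1 r + r • p.2) = r * (_ + _)
    -- The field `mul_ι` is precisely the linearity of the section on the summand `B`; on `N ⊗ B`
    -- linearity comes from that of `ν`.
    rw [mul_add, mul_ι, map_add, ← add_assoc]
    congr 1
    generalize p.2 = t
    induction t using TensorProduct.induction_on with
    | zero => simp
    | tmul x y => simp [TensorProduct.smul_tmul', mul_assoc]
    | add x y hx hy => simp only [smul_add, map_add, mul_add, hx, hy]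

/-- The projection from `R` onto the cone of `B`. -/
def toCone : R →ₗ[R] Cone c B := LinearMap.toSpanSingleton R (Cone c B) ((1, 0) : B × N ⊗[k] B)

theorem toCone_fst (r : R) : (c.toCone r).1 = c.π r := mul_one _

theorem toCone_snd (r : R) : (c.toCone r).2 = c.D r := by
  change c.act B 1 r + r • (0 : N ⊗[k] B) = c.D r
  rw [smul_zero, add_zero, act_apply]
  have h : (LinearMap.toSpanSingleton B B 1).restrictScalars k = LinearMap.id := by
    ext b
    simp
  rw [h, LinearMap.lTensor_id_apply]

/-- The cone of `B` plays the role of the direct summand of `R` cut out by the idempotent `ι 1`, so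
it is projective. -/
theorem toCone_comp_sec : c.toCone ∘ₗ c.sec = LinearMap.id := by
  refine LinearMap.ext fun p => ?_
  obtain ⟨b, t⟩ := p
  have hb : c.toCone (c.ι b) = ((b, 0) : B × N ⊗[k] B) :=
    Prod.ext ((c.toCone_fst _).trans (c.π_ι b)) ((c.toCone_snd _).trans (c.D_ι b))
  have ht : c.toCone (TensorProduct.lift
      ((LinearMap.mul k R).compl₁₂ (c.ν.restrictScalars k) c.ι) t) = ((0, t) : B × N ⊗[k] B) := by
    refine Prod.ext ((c.toCone_fst _).trans ?_) ((c.toCone_snd _).trans ?_)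
    · induction t using TensorProduct.induction_on with
      | zero => simp
      | tmul x y => simp [c.π_ν]
      | add x y hx hy => rw [map_add, map_add, hx, hy]; exact add_zero _
    · change c.D _ = t
      induction t using TensorProduct.induction_on with
      | zero => simp
      | tmul x y => simp [c.D_mul, c.D_ι, c.D_ν, c.π_ι]
      | add x y hx hy => rw [map_add, map_add, hx, hy]
  change c.toCone (_ + _) = _
  rw [map_add, hb, ht]
  exact Prod.ext (add_zero b) (zero_add t)

theorem map_comp (g : Y →ₗ[B] Z) (f : X →ₗ[B] Y) : c.map (g ∘ₗ f) = c.map g ∘ₗ c.map f :=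
  LinearMap.ext fun p => Prod.ext rfl
    (LinearMap.lTensor_comp_apply N (g.restrictScalars k) (f.restrictScalars k) p.2)

theorem map_id : c.map (LinearMap.id : X →ₗ[B] X) = LinearMap.id :=
  LinearMap.ext fun p => Prod.ext rfl (LinearMap.lTensor_id_apply N X p.2)

theorem map_sum {ι : Type*} (s : Finset ι) (f : ι → X →ₗ[B] Y) :
    c.map (∑ i ∈ s, f i) = ∑ i ∈ s, c.map (f i) := by
  have h0 : c.map (0 : X →ₗ[B] Y) = 0 := LinearMap.ext fun p => Prod.ext rfl (by
    change LinearMap.lTensor N (0 : X →ₗ[k] Y) p.2 = 0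
    simp)
  have hadd : ∀ f g : X →ₗ[B] Y, c.map (f + g) = c.map f + c.map g := fun f g =>
    LinearMap.ext fun p => Prod.ext rfl (by
      change LinearMap.lTensor N (f.restrictScalars k + g.restrictScalars k) p.2 = _
      rw [LinearMap.lTensor_add]; rfl)
  exact _root_.map_sum (⟨⟨c.map, h0⟩, hadd⟩ : (X →ₗ[B] Y) →+ (Cone c X →ₗ[R] Cone c Y)) f s

/-- A finitely generated projective `X` is a retract of `B ^ r`, and the cone is additive, so `Cone
c X` is a retract of `r` copies of `Cone c B`, hence of `R ^ r`. The maps are assembled coordinate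
by coordinate from `∑ i, e i ∘ₗ h i = id`. -/
theorem cone_projective [Module.Finite B X] [Module.Projective B X] :
    Module.Projective R (Cone c X) := by
  obtain ⟨r, f, g, -, -, hfg⟩ := Module.Finite.exists_comp_eq_id_of_projective B X
  let e (i : Fin r) : B →ₗ[B] X := f ∘ₗ LinearMap.single B (fun _ => B) i
  let h (i : Fin r) : X →ₗ[B] B := LinearMap.proj i ∘ₗ g
  have hid : ∑ i, e i ∘ₗ h i = LinearMap.id := by
    rw [← hfg]
    ext x
    simp only [LinearMap.sum_apply, LinearMap.comp_apply, e, h, ← _root_.map_sum]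
    congr 1
    exact LinearMap.sum_single_apply _ (g x)
  refine Module.Projective.of_split (R := R) (M := Fin r → R)
    (LinearMap.pi fun i => c.sec ∘ₗ c.map (h i))
    (LinearMap.lsum R (fun _ => R) ℕ fun i => c.map (e i) ∘ₗ c.toCone) ?_
  rw [← c.map_id, ← hid, c.map_sum]
  refine LinearMap.ext fun p => ?_
  simp only [LinearMap.comp_apply, LinearMap.lsum_apply, LinearMap.sum_apply, map_comp,
    LinearMap.proj_apply, LinearMap.pi_apply]
  refine Finset.sum_congr rfl fun i _ => ?_
  rw [← LinearMap.comp_apply c.toCone, toCone_comp_sec]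
  rfl

/-- Dimension shifting along a finite free cover of `X`, which the cone turns into a short exact
sequence with projective middle term. The bound `1` is a separate case: shifting from it would need
the free cover to have bound `0`. -/
theorem pdLT_cone [Module.Finite k B] [Module.Finite B X] {n : ℕ} (h : PdLT B X n) :
    PdLT R (Cone c X) n := by
  induction n using Nat.strong_induction_on generalizing X with
  | _ n ih =>
  match n with
  | 0 =>
    have := PdLT.zero_iff.1 h
    have : Subsingleton (N ⊗[k] X) := inferInstance
    exact PdLT.zero_iff.2 (inferInstanceAs (Subsingleton (X × N ⊗[k] X)))
  | 1 =>
    have := PdLT.one_iff.1 h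
    exact PdLT.one_iff.2 c.cone_projective
  | n + 2 =>
    obtain ⟨r, f, hf⟩ := Module.Finite.exists_fin' B X
    -- Noetherianity keeps the kernel finitely generated, as the induction hypothesis requires.
    have hB : IsNoetherian B B := isNoetherian_of_tower k inferInstance
    have hK : PdLT B (LinearMap.ker f) (n + 1) :=
      PdLT.left (LinearMap.ker f).subtype f Subtype.val_injective hf
        (LinearMap.exact_subtype_ker_map f)
        PdLT.of_projective h
    have := c.cone_projective (X := Fin r → B)
    exact PdLT.right (c.map (LinearMap.ker f).subtype) (c.map f)
      (c.map_injective _ Subtype.val_injective) (c.map_surjective _ hf)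
      (c.map_exact _ _ hf (LinearMap.exact_subtype_ker_map f)) (ih (n + 1) (by omega) hK)
      PdLT.of_projective

/-- Read off from `0 → N ⊗ X → Cone c X → X → 0`, where `N ⊗ X` is bounded through `N` and the cone
through `X`. -/
theorem pdLT_infl_aux [Module.Finite k B] [Module.Finite B X] {n : ℕ} (hX : PdLT B X (n + 1))
    (hN : PdLT R N n) : PdLT R (Infl c.π.toRingHom X) (n + 1) := by
  have : Module.Finite k X := Module.Finite.trans B X
  let f : N ⊗[k] X →ₗ[R] Cone c X :=
    { toFun := fun t => ((0, t) : X × N ⊗[k] X)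
      map_add' := fun s t => Prod.ext (add_zero (0 : X)).symm rfl
      map_smul' := fun r t => Prod.ext (smul_zero (c.π r)).symm (by
        change r • t = c.act X 0 r + r • t
        simp) }
  let g : Cone c X →ₗ[R] Infl c.π.toRingHom X :=
    { toFun := fun p => Infl.mk _ p.1
      map_add' := fun _ _ => rfl
      map_smul' := fun _ _ => rfl }
  refine PdLT.right f g (fun s t h => congrArg Prod.snd h) (fun x => ⟨((x, 0) : X × N ⊗[k] X), rfl⟩)
    (fun p => ⟨fun hp => ⟨p.2, Prod.ext (Eq.symm hp) rfl⟩, ?_⟩) hN.tensor (c.pdLT_cone hX)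
  rintro ⟨t, rfl⟩
  rfl

/-- If `pd X ≤ n` over `B` and `pd N < n` over `R`, then the inflation of `X` has `pd ≤ n`. -/
theorem pdLT_infl [Module.Finite k B] (X : Type u) [AddCommGroup X] [Module B X]
    [Module.Finite B X] {n : ℕ} (hX : PdLT B X (n + 1)) (hN : PdLT R N n) :
    PdLT R (Infl c.π.toRingHom X) (n + 1) := by
  let : Module k X := Module.compHom X (algebraMap k B)
  have : IsScalarTower k B X := ⟨fun t b x => by
    rw [Algebra.smul_def, mul_smul]; rfl⟩
  exact c.pdLT_infl_aux hX hN

end ConeData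

end

/-! ### Corners of modules, and reduction to corners over a triangular ring -/

section

open CategoryTheory TensorProduct

/-- The subgroup `φ(1) M` of an `R`-module `M`, for a ring homomorphism `φ : T → R` which need not
preserve `1`; it is a `T`-module. -/
def Corner {T R : Type u} [Ring T] [Ring R] (φ : T →ₙ+* R) (M : Type u) [AddCommGroup M]
    [Module R M] : AddSubgroup M where
  carrier := {m | φ 1 • m = m}
  zero_mem' := smul_zero _
  add_mem' {x y} hx hy := by
    simp only [Set.mem_ofPred_eq] at *
    rw [smul_add, hx, hy]
  neg_mem' {x} hx := by
    simp only [Set.mem_ofPred_eq] at *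
    rw [smul_neg, hx]

namespace Corner

variable {T R : Type u} [Ring T] [Ring R] (φ : T →ₙ+* R) {M N L : Type u} [AddCommGroup M]
  [Module R M] [AddCommGroup N] [Module R N] [AddCommGroup L] [Module R L]

theorem mem_iff {m : M} : m ∈ Corner φ M ↔ φ 1 • m = m := Iff.rfl

theorem smul_mem (t : T) (m : M) : φ t • m ∈ Corner φ M := by
  rw [mem_iff, smul_smul, ← map_mul, one_mul]

theorem smul_one_smul (t : T) (m : M) : φ t • φ 1 • m = φ t • m := by
  rw [smul_smul, ← map_mul, mul_one]

instance : Module T (Corner φ M) where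
  smul t m := ⟨φ t • m.1, smul_mem φ t m.1⟩
  one_smul m := Subtype.ext m.2
  mul_smul s t m := Subtype.ext <| by
    change φ (s * t) • m.1 = φ s • φ t • m.1
    rw [map_mul, mul_smul]
  smul_zero t := Subtype.ext (smul_zero (φ t))
  smul_add t x y := Subtype.ext (smul_add (φ t) x.1 y.1)
  add_smul s t m := Subtype.ext (by
    change φ (s + t) • m.1 = φ s • m.1 + φ t • m.1; rw [map_add, add_smul])
  zero_smul m := Subtype.ext (by change φ 0 • m.1 = 0; rw [map_zero, zero_smul])

/-- Multiplication by `φ(1)`. -/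
def proj : M →+ Corner φ M where
  toFun m := ⟨φ 1 • m, smul_mem φ 1 m⟩
  map_zero' := Subtype.ext (smul_zero _)
  map_add' x y := Subtype.ext (smul_add _ x y)

theorem proj_coe (m : Corner φ M) : proj φ (m : M) = m := Subtype.ext m.2

theorem proj_smul (t : T) (m : M) : proj φ (φ t • m) = t • proj φ m :=
  Subtype.ext (by
    change φ 1 • φ t • m = φ t • φ 1 • m
    rw [smul_one_smul, smul_smul, ← map_mul, one_mul])

/-- The corner is functorial. -/
def map (f : M →ₗ[R] N) : Corner φ M →ₗ[T] Corner φ N where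
  toFun m := ⟨f m, by rw [mem_iff, ← map_smul, (mem_iff φ).1 m.2]⟩
  map_add' x y := Subtype.ext (map_add f x.1 y.1)
  map_smul' t x := Subtype.ext (map_smul f (φ t) x.1)

theorem map_coe (f : M →ₗ[R] N) (m : Corner φ M) : (map φ f m : N) = f m := rfl

theorem map_injective (f : M →ₗ[R] N) (hf : Function.Injective f) :
    Function.Injective (map φ f) :=
  fun _ _ h => Subtype.ext (hf (congrArg Subtype.val h))

theorem map_surjective (f : M →ₗ[R] N) (hf : Function.Surjective f) :
    Function.Surjective (map φ f) := fun n => by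
  obtain ⟨m, hm⟩ := hf n
  exact ⟨proj φ m, Subtype.ext (by
    change f (φ 1 • m) = n
    rw [map_smul, hm]; exact n.2)⟩

theorem map_exact (f : M →ₗ[R] N) (g : N →ₗ[R] L) (hfg : Function.Exact f g) :
    Function.Exact (map φ f) (map φ g) := fun n => by
  constructor
  · intro hn
    obtain ⟨m, hm⟩ := (hfg n).1 (congrArg Subtype.val hn)
    exact ⟨proj φ m, Subtype.ext (by
      change f (φ 1 • m) = n
      rw [map_smul, hm]; exact n.2)⟩
  · rintro ⟨m, rfl⟩
    exact Subtype.ext ((hfg _).2 ⟨m, rfl⟩)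

/-- The comparison map from a power of the corner of `R` to the corner of a free module. -/
noncomputable def ofFinsupp (ι : Type u) : (ι →₀ Corner φ R) →ₗ[T] Corner φ (ι →₀ R) :=
  Finsupp.lsum ℕ fun i => map φ (Finsupp.lsingle i)

/-- The inverse of the comparison map. -/
noncomputable def toFinsupp (ι : Type u) : Corner φ (ι →₀ R) →ₗ[T] (ι →₀ Corner φ R) where
  toFun x := Finsupp.mapRange (proj φ) (map_zero _) x.1
  map_add' _ _ := Finsupp.mapRange_add (map_add _) _ _
  map_smul' t x := Finsupp.ext fun i => proj_smul φ t (x.1 i)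

theorem ofFinsupp_comp_toFinsupp (ι : Type u) :
    ofFinsupp φ ι ∘ₗ toFinsupp φ ι = LinearMap.id := by
  refine LinearMap.ext fun x => Subtype.ext ?_
  have h : ∀ y : ι →₀ R, (ofFinsupp φ ι (Finsupp.mapRange (proj φ) (map_zero _) y) : ι →₀ R) =
      φ 1 • y := by
    intro y
    induction y using Finsupp.induction_linear with
    | zero => simp
    | add y z hy hz => rw [Finsupp.mapRange_add (map_add _), map_add, AddSubgroup.coe_add, hy, hz,
        smul_add]
    | single i r =>
      rw [Finsupp.mapRange_single, ofFinsupp, Finsupp.lsum_single, map_coe, Finsupp.smul_single]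
      rfl
  exact (h x.1).trans x.2

/-- The corner of a free module is a retract of a direct sum of copies of the corner of `R`; a
general projective is a retract of a free module. -/
theorem projective [Module.Projective T (Corner φ R)] [Module.Projective R M] :
    Module.Projective T (Corner φ M) := by
  classical
  have : Module.Projective T (M →₀ Corner φ R) :=
    Module.Projective.of_equiv' (finsuppLequivDFinsupp T).symm
  have hF : Module.Projective T (Corner φ (M →₀ R)) :=
    Module.Projective.of_split (toFinsupp φ M) (ofFinsupp φ M) (ofFinsupp_comp_toFinsupp φ M)
  obtain ⟨s, hs⟩ := Module.projective_def'.1 ‹Module.Projective R M›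
  refine Module.Projective.of_split (map φ s) (map φ (Finsupp.linearCombination R id)) ?_
  exact LinearMap.ext fun x => Subtype.ext (LinearMap.congr_fun hs x.1)

theorem finite [Module.Finite T (Corner φ R)] [Module.Finite R M] :
    Module.Finite T (Corner φ M) := by
  obtain ⟨s, hs⟩ := Module.Finite.fg_top (R := R) (M := M)
  have h1 : Function.Surjective (ofFinsupp φ (s : Set M).Elem) := fun x =>
    ⟨toFinsupp φ _ x, LinearMap.congr_fun (ofFinsupp_comp_toFinsupp φ _) x⟩
  have h2 : Function.Surjective (Finsupp.linearCombination R ((↑) : (s : Set M).Elem → M)) := by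
    rw [← LinearMap.range_eq_top, Finsupp.range_linearCombination]
    simpa using hs
  exact Module.Finite.of_surjective (map φ _ ∘ₗ ofFinsupp φ _)
    ((map_surjective φ _ h2).comp h1)

/-- Taking corners is exact and preserves projectives, so dimension shifting along a free cover
applies. -/
theorem pdLT [Module.Projective T (Corner φ R)] {n : ℕ} (h : PdLT R M n) :
    PdLT T (Corner φ M) n := by
  induction n using Nat.strong_induction_on generalizing M with
  | _ n ih =>
  match n with
  | 0 =>
    have := PdLT.zero_iff.1 h
    exact PdLT.zero_iff.2 inferInstance
  | 1 =>
    have := PdLT.one_iff.1 h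
    exact PdLT.one_iff.2 (projective φ)
  | n + 2 =>
    let f : (M →₀ R) →ₗ[R] M := Finsupp.linearCombination R id
    have hf : Function.Surjective f := Finsupp.linearCombination_id_surjective R M
    have hK : PdLT R (LinearMap.ker f) (n + 1) :=
      PdLT.left (LinearMap.ker f).subtype f Subtype.val_injective hf
        (LinearMap.exact_subtype_ker_map f) PdLT.of_projective h
    have := projective φ (M := M →₀ R)
    exact PdLT.right (map φ (LinearMap.ker f).subtype) (map φ f)
      (map_injective φ _ Subtype.val_injective) (map_surjective φ _ hf)
      (map_exact φ _ _ (LinearMap.exact_subtype_ker_map f)) (ih (n + 1) (by omega) hK)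
      PdLT.of_projective

end Corner

/-- A module over a triangular ring has projective dimension less than `n` if this holds for the
inflations of all its corners. -/
theorem PdLT.of_corners {V : Type u} [Fintype V] {R : Type u} [Ring R] {T : V → Type u}
    [∀ j, Ring (T j)] (π : ∀ j, R →+* T j) (φ : ∀ j, T j →ₙ+* R) (lt : V → V → Prop)
    (hlt : WellFounded lt) (hsum : ∑ j, φ j 1 = 1)
    (horth : ∀ j l, l ≠ j → φ j 1 * φ l 1 = 0)
    (hdiag : ∀ j r, φ j 1 * r * φ j 1 = φ j (π j r))
    (hoff : ∀ j l r, l ≠ j → ¬ lt l j → φ j 1 * r * φ l 1 = 0)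
    {n : ℕ} (M : Type u) [AddCommGroup M] [Module R M]
    (h : ∀ j, PdLT R (Infl (π j) (Corner (φ j) M)) n) : PdLT R M n := by
  classical
  have hdec : ∀ (N : Type u) [AddCommGroup N] [Module R N] (m : N), m = ∑ j, φ j 1 • m := by
    intro N _ _ m
    rw [← Finset.sum_smul, hsum, one_smul]
  -- Induction on a set `U` of indices outside which every corner of the module vanishes.
  suffices H : ∀ (U : Finset V) (N : Type u) [AddCommGroup N] [Module R N],
      (∀ j ∉ U, ∀ m : N, φ j 1 • m = 0) →
      (∀ j, PdLT R (Infl (π j) (Corner (φ j) N)) n) → PdLT R N n from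
    H Finset.univ M (fun j hj => (hj (Finset.mem_univ j)).elim) h
  intro U
  induction U using Finset.strongInduction with
  | _ U ih =>
  intro N _ _ hU hN
  by_cases hne : U.Nonempty
  · obtain ⟨j, hjU, hmin⟩ := hlt.has_min (U : Set V) hne
    let g : N →ₗ[R] Infl (π j) (Corner (φ j) N) :=
      { toFun := fun m => Infl.mk (π j) (Corner.proj (φ j) m)
        map_add' := fun x y => by rw [map_add, map_add]
        map_smul' := fun r m => by
          rw [RingHom.id_apply, Infl.smul_mk]
          congr 1
          refine Subtype.ext ?_
          change φ j 1 • r • m = φ j (π j r) • φ j 1 • m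
          rw [Corner.smul_one_smul, ← hdiag]
          conv_lhs => rw [hdec N m]
          rw [Finset.smul_sum, Finset.smul_sum, Finset.sum_eq_single j]
          · simp only [smul_smul, mul_assoc]
          · intro l _ hl
            by_cases hlU : l ∈ U
            · rw [smul_smul, smul_smul, hoff j l r hl (hmin l hlU), zero_smul]
            · rw [hU l hlU, smul_zero, smul_zero]
          · simp }
    have hg : Function.Surjective g := fun x =>
      ⟨((Infl.mk (π j)).symm x : Corner (φ j) N).1, Corner.proj_coe (φ j) _⟩
    have hker : ∀ m : LinearMap.ker g, φ j 1 • (m : N) = 0 := fun m =>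
      congrArg Subtype.val (m.2 : g m = 0)
    refine PdLT.middle (LinearMap.ker g).subtype g Subtype.val_injective hg
      (LinearMap.exact_subtype_ker_map g) ?_ (hN j)
    refine ih (U.erase j) (Finset.erase_ssubset hjU) _ (fun l hl m => ?_) (fun l => ?_)
    · refine Subtype.ext ?_
      by_cases hlj : l = j
      · subst hlj; exact hker m
      · exact hU l (fun hlU => hl (Finset.mem_erase.2 ⟨hlj, hlU⟩)) m
    · by_cases hlj : l = j
      · subst hlj
        have : Subsingleton (Corner (φ l) (LinearMap.ker g)) := by
          refine subsingleton_of_forall_eq 0 fun m => Subtype.ext ?_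
          rw [← (Corner.mem_iff (φ l)).1 m.2]
          exact Subtype.ext (hker m.1)
        exact PdLT.of_subsingleton
      · refine Infl.pdLT_equiv (π l) (LinearEquiv.ofBijective
          (Corner.map (φ l) (LinearMap.ker g).subtype)
          ⟨Corner.map_injective (φ l) _ Subtype.val_injective, fun x => ?_⟩) (hN l)
        have hx : φ l 1 • (x : N) = x := x.2
        have hx' : g x = 0 := by
          refine Subtype.ext ?_
          change φ j 1 • (x : N) = 0
          rw [← hx, smul_smul, horth j l hlj, zero_smul]
        exact ⟨⟨⟨x, hx'⟩, Subtype.ext hx⟩, rfl⟩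
  · rw [Finset.not_nonempty_iff_eq_empty] at hne
    have : Subsingleton N := subsingleton_of_forall_eq 0 fun m => by
      rw [hdec N m]
      exact Finset.sum_eq_zero fun j _ => hU j (by simp [hne]) m
    exact PdLT.of_subsingleton

end

/-! ### Quotients of generalized path algebras, and maps read off from the first arrow -/

section

open TensorProduct MulOpposite

namespace APath

variable {V : Type u} [Quiver.{u} V] {A : V → Type u} [∀ i, Ring (A i)]

/-- An `𝒜`-path of positive length factors through its first arrow. -/
theorem cons_eq_mul {i j l : V} (x : APath A i j) (β : j ⟶ l) (b : A l) :
    ∃ (m : V) (γ : i ⟶ m) (a : A i) (w : APath A m l),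
      x.cons β b = ((nil a).cons γ 1).mul w := by
  induction x generalizing l with
  | nil a => exact ⟨l, β, a, nil b, by simp [mul, rmul]⟩
  | cons x β' b' ih =>
    obtain ⟨m, γ, a, w, h⟩ := ih β' b'
    exact ⟨m, γ, a, w.cons β b, by rw [h]; rfl⟩

-- The inductive type grows at the right end, whereas the maps below depend on the first arrow and
-- the entry before it.
@[elab_as_elim]
theorem left_cases {i : V} {motive : ∀ j, APath A i j → Prop}
    (nil : ∀ a : A i, motive i (nil a))
    (mul : ∀ (m : V) (γ : i ⟶ m) (a : A i) (j : V) (w : APath A m j),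
      motive j (((APath.nil a).cons γ 1).mul w)) {j : V} (x : APath A i j) : motive j x := by
  cases x with
  | nil a => exact nil a
  | cons x β b =>
    obtain ⟨m, γ, a, w, h⟩ := cons_eq_mul x β b
    rw [h]
    exact mul m γ a _ w

theorem nil_mul_cons_mul {i m j : V} (a b : A i) (γ : i ⟶ m) (w : APath A m j) :
    (nil a).mul (((nil b).cons γ 1).mul w) = ((nil (a * b)).cons γ 1).mul w := by
  rw [← mul_assoc']
  rfl

end APath

noncomputable section

namespace GPA

variable {k : Type u} [Field k] {V : Type u} [Quiver.{u} V] {A : V → Type u}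
  [∀ i, Ring (A i)] [∀ i, Algebra k (A i)] [Fintype V]

/-- The ideal is additively generated by products `a * r * b` with `r ∈ s`; paths span the algebra,
so by linearity `a` and `b` may be taken to be paths. -/
theorem map_span_eq_zero {W : Type*} [AddCommGroup W] [Module k W] {s : Set (GPA k A)}
    (f : GPA k A →ₗ[k] W) (h : ∀ v ∈ s, ∀ (i j : V) (x : APath A i j) (l m : V) (y : APath A l m),
      f (of k A x * v * of k A y) = 0) {v : GPA k A} (hv : v ∈ TwoSidedIdeal.span s) : f v = 0 := by
  rw [TwoSidedIdeal.mem_span_iff_mem_addSubgroup_closure] at hv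
  induction hv using AddSubgroup.closure_induction with
  | mem v hv =>
    obtain ⟨_, ⟨a, -, r, hr, rfl⟩, b, -, rfl⟩ := hv
    have h1 : ∀ (i j : V) (x : APath A i j), f (of k A x * r * b) = 0 := fun i j x => by
      have : f ∘ₗ LinearMap.mulLeft k (of k A x * r) = 0 :=
        hom_ext k fun l m y => h r hr i j x l m y
      exact LinearMap.congr_fun this b
    have : f ∘ₗ LinearMap.mulRight k b ∘ₗ LinearMap.mulRight k r = 0 := hom_ext k h1
    exact LinearMap.congr_fun this a
  | zero => exact map_zero f
  | add x y _ _ hx hy => rw [map_add, hx, hy, add_zero]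
  | neg x _ hx => rw [map_neg, hx, neg_zero]

end GPA

section Quotient

variable {k : Type u} [Field k] {V : Type u} [Quiver.{u} V] {A : V → Type u}
  [∀ i, Ring (A i)] [∀ i, Algebra k (A i)] [Fintype V]

/-- The quotient of a generalized path algebra by a two-sided ideal. -/
def GPQ (J : TwoSidedIdeal (GPA k A)) : Type u := GPA k A ⧸ J.asIdeal

namespace GPQ

variable (J : TwoSidedIdeal (GPA k A))

instance : Ring (GPQ J) := inferInstanceAs (Ring (GPA k A ⧸ J.asIdeal))

instance : Algebra k (GPQ J) := inferInstanceAs (Algebra k (GPA k A ⧸ J.asIdeal))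

/-- The quotient map. -/
def mk : GPA k A →ₐ[k] GPQ J where
  __ := Ideal.Quotient.mk J.asIdeal
  commutes' _ := rfl

theorem mk_surjective : Function.Surjective (mk J) := Ideal.Quotient.mk_surjective

variable {J} in
theorem mk_eq_zero {v : GPA k A} : mk J v = 0 ↔ v ∈ J :=
  Ideal.Quotient.eq_zero_iff_mem.trans TwoSidedIdeal.mem_asIdeal

/-- The class of an `𝒜`-path. -/
def cl {i j : V} (x : APath A i j) : GPQ J := mk J (GPA.of k A x)

variable {i j l m : V}

theorem cl_mul (x : APath A i j) (y : APath A j l) : cl J (x.mul y) = cl J x * cl J y := by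
  rw [cl, cl, cl, ← map_mul, GPA.of_mul_of]

theorem cl_mul_ne (h : l ≠ j) (x : APath A i j) (y : APath A l m) : cl J x * cl J y = 0 := by
  rw [cl, cl, ← map_mul, GPA.of_mul_of_ne k h, map_zero]

theorem cl_add {x y z : APath A i j} (h : APath.IsAdd x y z) : cl J x = cl J y + cl J z := by
  rw [cl, GPA.of_add k h, map_add]; rfl

theorem cl_smul {t : k} {x y : APath A i j} (h : APath.IsSMul t x y) : cl J x = t • cl J y := by
  rw [cl, GPA.of_smul k h, map_smul]; rfl

theorem one_eq : (1 : GPQ J) = ∑ i : V, cl J (APath.nil (1 : A i)) := by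
  rw [← map_one (mk J), GPA.one_def, map_sum]; rfl

variable {J} in
theorem hom_ext {W : Type*} [AddCommGroup W] [Module k W] {f g : GPQ J →ₗ[k] W}
    (h : ∀ (i j : V) (x : APath A i j), f (cl J x) = g (cl J x)) : f = g := by
  have : f ∘ₗ (mk J).toLinearMap = g ∘ₗ (mk J).toLinearMap := GPA.hom_ext k h
  refine LinearMap.ext fun v => ?_
  obtain ⟨v, rfl⟩ := mk_surjective J v
  exact LinearMap.congr_fun this v

variable {J} in
/-- The linear map on the quotient induced by a linear map which vanishes on the ideal. -/
def lift {W : Type*} [AddCommGroup W] [Module k W] (f : GPA k A →ₗ[k] W)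
    (hf : ∀ v ∈ J, f v = 0) : GPQ J →ₗ[k] W where
  toFun := QuotientAddGroup.lift J.asIdeal.toAddSubgroup f.toAddMonoidHom
    fun v hv => hf v (TwoSidedIdeal.mem_asIdeal.1 hv)
  map_add' := map_add _
  map_smul' t v := by
    obtain ⟨v, rfl⟩ := mk_surjective J v
    exact map_smul f t v

theorem lift_cl {W : Type*} [AddCommGroup W] [Module k W] (f : GPA k A →ₗ[k] W)
    (hf : ∀ v ∈ J, f v = 0) (x : APath A i j) : lift f hf (cl J x) = f (GPA.of k A x) := rfl

/-- The inclusion of the algebra at a vertex. -/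
def ι (j : V) : A j →ₗ[k] GPQ J where
  toFun a := cl J (APath.nil a)
  map_add' a b := cl_add J (APath.IsAdd.nil a b)
  map_smul' _ a := cl_smul J (APath.IsSMul.nil a)

theorem ι_mul (a b : A j) : ι J j (a * b) = ι J j a * ι J j b :=
  cl_mul J (APath.nil a) (APath.nil b)

theorem ι_mul_ι_ne (h : l ≠ j) (a : A j) (b : A l) : ι J j a * ι J l b = 0 :=
  cl_mul_ne J h (APath.nil a) (APath.nil b)

/-- The class of an arrow. -/
def ar (β : i ⟶ j) : GPQ J := cl J ((APath.nil (1 : A i)).cons β 1)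

theorem cl_eq_ι_mul (γ : i ⟶ m) (a : A i) (w : APath A m j) :
    cl J (((APath.nil a).cons γ 1).mul w) = ι J i a * ar J γ * cl J w := by
  rw [cl_mul]
  congr 1
  refine Eq.trans ?_ (cl_mul J (APath.nil a) ((APath.nil 1).cons γ 1))
  simp [APath.mul, APath.rmul]

theorem cl_cons (x : APath A i j) (β : j ⟶ l) (b : A l) :
    cl J (x.cons β b) = cl J (x.cons β 1) * ι J l b := by
  refine Eq.trans ?_ (cl_mul J (x.cons β 1) (APath.nil b))
  simp [APath.mul, APath.rmul]

theorem ι_one_mul (x : APath A i j) : ι J i 1 * cl J x = cl J x := by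
  refine (cl_mul J (APath.nil 1) x).symm.trans ?_
  rw [APath.one_mul']

theorem mul_ι_one (x : APath A i j) : cl J x * ι J j 1 = cl J x := by
  refine (cl_mul J x (APath.nil 1)).symm.trans ?_
  rw [APath.mul_one']

/-! #### Derivations determined by the first arrow -/

section LeftD

variable {T : Type u} [AddCommGroup T] [Module k T] [Module (GPQ J)ᵐᵒᵖ T]
  (θ : ∀ i l : V, (i ⟶ l) → A i →ₗ[k] T)

/-- The contribution of the last arrow, present if this is also the first one. -/
def headD : ∀ {j l : V}, APath A i j → (j ⟶ l) → A l → T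
  | _, l, .nil a, β, b => op (ι J l b) • θ _ _ β a
  | _, _, .cons _ _ _, _, _ => 0

/-- The map `a β w ↦ θ_β(a) w`. -/
def leftD : ∀ {j : V}, APath A i j → T
  | _, .nil _ => 0
  | _, .cons x β b => op (cl J ((APath.nil 1).cons β b)) • leftD x + headD J θ x β b

/-- Only the first arrow and the entry before it are altered, so whatever is appended acts through
the module `T`. Positive length is essential, since `leftD` kills paths of length zero. -/
theorem leftD_cons_mul (x : APath A i j) (β : j ⟶ l) (b : A l) (w : APath A l m) :
    leftD J θ ((x.cons β b).mul w) = op (cl J w) • leftD J θ (x.cons β b) := by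
  induction w with
  | nil c =>
    change leftD J θ (x.cons β (b * c)) = _
    rw [leftD, leftD, smul_add, smul_smul, ← op_mul]
    congr 1
    · congr 2
      exact cl_mul J ((APath.nil 1).cons β b) (APath.nil c)
    · cases x with
      | nil a =>
        rw [headD, headD, smul_smul, ← op_mul, ι_mul]; rfl
      | cons => rw [headD, headD, smul_zero]
  | cons w γ c ih =>
    -- Once a path contains an arrow, the next arrow is not its first one, so there is no head term.
    have hc : ∀ {p q r : V} (x' : APath A i p) (γ' : p ⟶ q) (w' : APath A q r),
        ∀ {s} (δ : r ⟶ s) (e : A s) (f : A q), headD J θ ((x'.cons γ' f).mul w') δ e = (0 : T) := by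
      intro p q r x' γ' w' s δ e f
      cases w' <;> rfl
    change leftD J θ (((x.cons β b).mul w).cons γ c) = _
    rw [leftD, hc, add_zero, ih, smul_smul, ← op_mul, ← cl_mul, APath.mul, APath.mul,
      APath.rmul_one]

theorem leftD_mul (γ : i ⟶ m) (a : A i) (w : APath A m j) :
    leftD J θ (((APath.nil a).cons γ 1).mul w) = op (cl J w) • θ i m γ a := by
  rw [leftD_cons_mul, leftD, leftD, smul_zero, zero_add, headD, smul_smul, ← op_mul, ι_one_mul]

theorem leftD_isAdd {x y z : APath A i j} (h : APath.IsAdd x y z) :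
    leftD J θ x = leftD J θ y + leftD J θ z := by
  induction h with
  | nil a b => simp [leftD]
  | last x β a b =>
    have h1 := congrArg op (cl_add J (APath.IsAdd.last (APath.nil 1) β a b))
    simp only [leftD]
    rw [h1, op_add, add_smul]
    have h2 : headD J θ x β (a + b) = headD J θ x β a + headD J θ x β b := by
      cases x with
      | nil c => simp only [headD, map_add, op_add, add_smul]
      | cons => simp only [headD, add_zero]
    rw [h2]; abel
  | cons h β c ih =>
    simp only [leftD, ih, smul_add]
    have h2 : ∀ {p q r : V} {x y z : APath A p q} (h : APath.IsAdd x y z) (β : q ⟶ r) (c : A r),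
        headD J θ x β c = headD J θ y β c + headD J θ z β c := by
      intro p q r x y z h β c
      cases h with
      | nil a b => simp only [headD, map_add, smul_add]
      | last => simp only [headD, add_zero]
      | cons => simp only [headD, add_zero]
    rw [h2 h]; abel

variable [IsScalarTower k (GPQ J)ᵐᵒᵖ T]

theorem leftD_isSMul {t : k} {x y : APath A i j} (h : APath.IsSMul t x y) :
    leftD J θ x = t • leftD J θ y := by
  induction h with
  | nil a => simp [leftD]
  | last x β a =>
    have h1 := congrArg op (cl_smul J (APath.IsSMul.last (t := t) (APath.nil 1) β a))
    simp only [leftD]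
    rw [h1, op_smul, smul_add, smul_assoc]
    congr 1
    cases x with
    | nil c => simp only [headD, map_smul, op_smul, smul_assoc]
    | cons => simp only [headD, smul_zero]
  | cons h β c ih =>
    simp only [leftD, ih, smul_add, smul_comm t]
    congr 1
    cases h with
    | nil a => simp only [headD, map_smul, smul_comm t]
    | last => simp only [headD, smul_zero]
    | cons => simp only [headD, smul_zero]

/-- The linear extension of `leftD`. -/
def leftL : GPA k A →ₗ[k] T :=
  GPA.lift k (fun _ _ x => leftD J θ x) (fun _ _ _ _ _ h => leftD_isAdd J θ h)
    (fun _ _ _ _ _ h => leftD_isSMul J θ h)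

theorem leftL_of (x : APath A i j) : leftL J θ (GPA.of k A x) = leftD J θ x := GPA.lift_of _ _ _ _ _

end LeftD

end GPQ

end Quotient

end

end

/-! ### Projections to the vertex algebras, and splitting off the first or last entry -/

section

open TensorProduct MulOpposite

noncomputable section

section Diagonal

variable {k : Type u} [Field k] {V : Type u} [Quiver.{u} V] {A : V → Type u}
  [∀ i, Ring (A i)] [∀ i, Algebra k (A i)]

open Classical in
/-- The component of length zero of an `𝒜`-path. -/
def APath.diag {i : V} : ∀ {j : V}, APath A i j → ∀ l, A l
  | _, .nil a => Pi.single i a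
  | _, .cons _ _ _ => 0

/-- The paths which start with the entry `1` followed by an arrow. -/
def APath.HeadOne {i j : V} (x : APath A i j) : Prop :=
  ∃ (m : V) (γ : i ⟶ m) (w : APath A m j), x = ((APath.nil 1).cons γ 1).mul w

/-- The paths which end with an arrow followed by the entry `1`. -/
def APath.TailOne {i j : V} (x : APath A i j) : Prop :=
  ∃ (m : V) (y : APath A i m) (γ : m ⟶ j), x = y.cons γ 1

namespace GPA

variable (k A) in
/-- The component of length zero, as a linear map. -/
def diagL : GPA k A →ₗ[k] ∀ l, A l :=
  GPA.lift k (fun _ _ x => x.diag)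
    (fun _ _ _ _ _ h => by cases h <;> simp [APath.diag, Pi.single_add])
    (fun _ _ _ _ _ h => by cases h <;> simp [APath.diag, Pi.single_smul])

theorem diagL_of {i j : V} (x : APath A i j) : diagL k A (of k A x) = x.diag :=
  GPA.lift_of _ _ _ _ _

theorem diagL_nil [DecidableEq V] {i : V} (a : A i) :
    diagL k A (of k A (.nil a)) = Pi.single i a := by
  rw [diagL_of, APath.diag]; congr!

theorem diagL_cons {i j l : V} (x : APath A i j) (β : j ⟶ l) (b : A l) :
    diagL k A (of k A (x.cons β b)) = 0 := diagL_of _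

variable [Fintype V]

variable (k A) in
/-- The projection of the generalized path algebra onto the product of the algebras. -/
def diag : GPA k A →ₐ[k] ∀ l, A l :=
  AlgHom.ofLinearMap (diagL k A)
    (by
      classical
      rw [one_def, map_sum]
      simp only [diagL_nil]
      exact Finset.univ_sum_single (1 : ∀ l, A l))
    (fun v w => by
      classical
      have : (LinearMap.mul k (GPA k A)).compr₂ (diagL k A) =
          (LinearMap.mul k (∀ l, A l)).compl₁₂ (diagL k A) (diagL k A) := by
        refine hom_ext k fun i j x => hom_ext k fun i' j' y => ?_
        change diagL k A (of k A x * of k A y) = diagL k A (of k A x) * diagL k A (of k A y)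
        by_cases h : i' = j
        · subst h
          rw [of_mul_of]
          cases y with
          | nil b =>
            cases x with
            | nil a => rw [APath.mul, APath.rmul, diagL_nil, diagL_nil, diagL_nil, Pi.single_mul]
            | cons => rw [APath.mul, APath.rmul, diagL_cons, diagL_cons, zero_mul]
          | cons => rw [APath.mul, diagL_cons, diagL_cons, mul_zero]
        · rw [of_mul_of_ne k h, map_zero]
          cases y with
          | nil b =>
            cases x with
            | nil a =>
              rw [diagL_nil, diagL_nil]
              ext l
              by_cases hl : l = i
              · subst hl; simp [Pi.single_eq_of_ne (Ne.symm h)]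
              · simp [Pi.single_eq_of_ne hl]
            | cons => rw [diagL_cons, zero_mul]
          | cons => rw [diagL_cons, mul_zero]
      exact LinearMap.congr_fun (LinearMap.congr_fun this v) w)

theorem diag_nil [DecidableEq V] {i : V} (a : A i) :
    diag k A (of k A (.nil a)) = Pi.single i a := diagL_nil a

theorem diag_cons {i j l : V} (x : APath A i j) (β : j ⟶ l) (b : A l) :
    diag k A (of k A (x.cons β b)) = 0 := diagL_cons x β b

/-- The ideal `J` is generated by elements obtained from relations in `I` by replacing paths with
`𝒜`-paths of positive length whose end entries are `1`. -/
def GeneratedBy (I : ∀ i j : V, Set (Quiver.Path i j →₀ k)) (J : TwoSidedIdeal (GPA k A)) : Prop :=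
  ∃ s : Set (GPA k A), J = TwoSidedIdeal.span s ∧ ∀ v ∈ s, ∃ (i j : V), ∃ ρ ∈ I i j,
    ∃ x : Quiver.Path i j → APath A i j, (∀ p ∈ ρ.support, (x p).HeadOne ∧ (x p).TailOne) ∧
      v = ρ.sum fun p t => t • GPA.of k A (x p)

/-- It suffices to test relations placed between two paths. The relation may be assumed to vanish in
the quotient because generators lie in `J`; this is useful for maps whose values already involve
`GPQ J`. -/
theorem GeneratedBy.map_eq_zero {I : ∀ i j : V, Set (Quiver.Path i j →₀ k)}
    {J : TwoSidedIdeal (GPA k A)} (hJ : GeneratedBy I J) {W : Type*} [AddCommGroup W] [Module k W]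
    (f : GPA k A →ₗ[k] W)
    (h : ∀ (i j : V) (ρ : Quiver.Path i j →₀ k), ρ ∈ I i j → ∀ x : Quiver.Path i j → APath A i j,
      (∀ p ∈ ρ.support, (x p).HeadOne ∧ (x p).TailOne) →
      (ρ.sum fun p t => t • GPQ.cl J (x p)) = 0 →
      ∀ (i' j' : V) (u : APath A i' i) (w : APath A j j'),
        (ρ.sum fun p t => t • f (of k A (u.mul ((x p).mul w)))) = 0) :
    ∀ v ∈ J, f v = 0 := by
  intro v hv
  obtain ⟨s, hs, hs'⟩ := hJ
  rw [hs] at hv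
  refine map_span_eq_zero f (fun v hv i' j u l j' w => ?_) hv
  have hvJ : v ∈ J := hs ▸ TwoSidedIdeal.subset_span hv
  obtain ⟨i, j₁, ρ, hρ, x, hx, rfl⟩ := hs' v hv
  by_cases h1 : i = j
  · by_cases h2 : l = j₁
    · subst h1 h2
      refine Eq.trans ?_ (h _ _ ρ hρ x hx ?_ _ _ u w)
      · simp only [Finsupp.sum, Finset.mul_sum, Finset.sum_mul, map_sum, mul_smul_comm,
          smul_mul_assoc, map_smul, of_mul_of, APath.mul_assoc']
      · rw [← GPQ.mk_eq_zero] at hvJ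
        simp only [Finsupp.sum, map_sum, map_smul] at hvJ
        exact hvJ
    · simp only [Finsupp.sum, Finset.mul_sum, Finset.sum_mul, mul_smul_comm,
          smul_mul_assoc, mul_assoc, of_mul_of_ne k h2, mul_zero, map_zero, smul_zero,
          Finset.sum_const_zero]
  · simp only [Finsupp.sum, Finset.mul_sum, mul_smul_comm, of_mul_of_ne k h1, zero_mul, map_zero,
      smul_zero, Finset.sum_const_zero]

end GPA

end Diagonal

namespace GPQ

variable {k : Type u} [Field k] {V : Type u} [Quiver.{u} V] {A : V → Type u}
  [∀ i, Ring (A i)] [∀ i, Algebra k (A i)] [Fintype V]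
  {I : ∀ i j : V, Set (Quiver.Path i j →₀ k)} {J : TwoSidedIdeal (GPA k A)}

theorem sum_cl_mul_eq_zero {κ : Type*} {i j l : V} {ρ : κ →₀ k} {x : κ → APath A i j}
    (h : (ρ.sum fun p t => t • cl J (x p)) = 0) (w : APath A j l) :
    (ρ.sum fun p t => t • cl J ((x p).mul w)) = 0 := by
  have := congrArg (· * cl J w) h
  simpa only [Finsupp.sum, Finset.sum_mul, smul_mul_assoc, ← cl_mul, zero_mul] using this

theorem sum_mul_cl_eq_zero {κ : Type*} {i j l : V} {ρ : κ →₀ k} {x : κ → APath A i j}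
    (h : (ρ.sum fun p t => t • cl J (x p)) = 0) (u : APath A l i) :
    (ρ.sum fun p t => t • cl J (u.mul (x p))) = 0 := by
  have := congrArg (cl J u * ·) h
  simpa only [Finsupp.sum, Finset.mul_sum, mul_smul_comm, ← cl_mul, mul_zero] using this

section

variable (hJ : GPA.GeneratedBy I J)

theorem diag_eq_zero (hJ : GPA.GeneratedBy I J) : ∀ v ∈ J, GPA.diag k A v = 0 := by
  refine hJ.map_eq_zero (GPA.diag k A).toLinearMap fun i j ρ hρ x hx _ i' j' u w => ?_
  refine Finset.sum_eq_zero fun p hp => ?_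
  obtain ⟨⟨m, γ, w', h⟩, -⟩ := hx p hp
  have h0 : GPA.diag k A (GPA.of k A (x p)) = 0 := by
    rw [h, ← GPA.of_mul_of, map_mul, GPA.diag_cons, zero_mul]
  simp only [AlgHom.toLinearMap_apply, ← GPA.of_mul_of, map_mul, h0, zero_mul, mul_zero, smul_zero]

/-- The projection onto the product of the algebras at the vertices. -/
def diag : GPQ J →ₐ[k] ∀ l, A l :=
  AlgHom.ofLinearMap (lift (GPA.diag k A).toLinearMap (diag_eq_zero hJ)) (map_one (GPA.diag k A))
    (fun v w => by
      obtain ⟨v, rfl⟩ := mk_surjective J v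
      obtain ⟨w, rfl⟩ := mk_surjective J w
      exact map_mul (GPA.diag k A) v w)

/-- The projection onto the algebra at a vertex. -/
def π (j : V) : GPQ J →ₐ[k] A j := (Pi.evalAlgHom k A j).comp (diag hJ)

theorem π_nil [DecidableEq V] (j : V) {i : V} (a : A i) :
    π hJ j (cl J (.nil a)) = (Pi.single i a : ∀ l, A l) j :=
  congrFun (GPA.diag_nil (k := k) a) j

theorem π_ι (j : V) (a : A j) : π hJ j (ι J j a) = a := by
  classical
  exact (π_nil hJ j a).trans (by simp)

theorem π_cons (j : V) {i l m : V} (x : APath A i l) (β : l ⟶ m) (b : A m) :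
    π hJ j (cl J (x.cons β b)) = 0 :=
  congrFun (GPA.diag_cons (k := k) x β b) j

theorem π_surjective (j : V) : Function.Surjective (π hJ j) := fun a => ⟨ι J j a, π_ι hJ j a⟩

end

section LeftLift

variable {T : Type u} [AddCommGroup T] [Module k T] [Module (GPQ J)ᵐᵒᵖ T]
  [IsScalarTower k (GPQ J)ᵐᵒᵖ T] (θ : ∀ i l : V, (i ⟶ l) → A i →ₗ[k] T)

/-- The condition on `θ` which ensures that `a β w ↦ θ_β(a) w` is defined modulo the relations. -/
def Respects (I : ∀ i j : V, Set (Quiver.Path i j →₀ k)) : Prop :=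
  ∀ (i j : V) (ρ : Quiver.Path i j →₀ k), ρ ∈ I i j → ∀ x : Quiver.Path i j → APath A i j,
    (∀ p ∈ ρ.support, (x p).HeadOne) → (ρ.sum fun p t => t • cl J (x p)) = 0 →
      ∀ a : A i, (ρ.sum fun p t => t • leftD J θ ((APath.nil a).mul (x p))) = 0

variable {θ}

/-- If the path `u` before the relation has length zero, the first arrow lies inside the relation
and `Respects` applies. Otherwise the relation sits in the tail, which acts on `T` through the
quotient, hence as zero. -/
theorem leftL_eq_zero (hJ : GPA.GeneratedBy I J) (hθ : Respects (J := J) θ I) :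
    ∀ v ∈ J, leftL J θ v = 0 := by
  refine hJ.map_eq_zero (leftL J θ) fun i j ρ hρ x hx hsum i' j' u w => ?_
  simp only [leftL_of]
  cases u with
  | nil a =>
    have h := hθ i j ρ hρ x (fun p hp => (hx p hp).1) hsum a
    have h1 := congrArg (op (cl J w) • ·) h
    simp only [Finsupp.sum, Finset.smul_sum, smul_zero] at h1
    refine Eq.trans (Finset.sum_congr rfl fun p hp => ?_) h1
    obtain ⟨m, γ, w', h⟩ := (hx p hp).1
    change ρ p • _ = _
    rw [h, APath.mul_assoc', APath.nil_mul_cons_mul, APath.nil_mul_cons_mul, leftD_mul, leftD_mul,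
      cl_mul, op_mul, mul_smul, smul_comm (ρ p)]
  | cons u β b =>
    simp only [leftD_cons_mul]
    have h := sum_cl_mul_eq_zero hsum w
    have h1 := congrArg (fun z => op z • leftD J θ (u.cons β b)) h
    simpa only [Finsupp.sum, Finset.op_sum, Finset.sum_smul, MulOpposite.op_smul, smul_assoc,
      op_zero, zero_smul] using h1

/-- The linear map `a β w ↦ θ_β(a) w` on the quotient. -/
def left (hJ : GPA.GeneratedBy I J) (hθ : Respects (J := J) θ I) : GPQ J →ₗ[k] T :=
  lift (leftL J θ) (leftL_eq_zero hJ hθ)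

variable (hJ : GPA.GeneratedBy I J) (hθ : Respects (J := J) θ I) {i j l m : V}

theorem left_cl (x : APath A i j) : left hJ hθ (cl J x) = leftD J θ x :=
  (lift_cl _ _ _ _).trans (leftL_of J θ x)

theorem left_nil (a : A i) : left hJ hθ (cl J (.nil a)) = 0 := left_cl hJ hθ _

theorem left_mul (γ : i ⟶ m) (a : A i) (w : APath A m j) :
    left hJ hθ (cl J (((APath.nil a).cons γ 1).mul w)) = op (cl J w) • θ i m γ a :=
  (left_cl hJ hθ _).trans (leftD_mul J θ γ a w)

theorem left_cons_mul (x : APath A i j) (β : j ⟶ l) (b : A l) (v : GPQ J) :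
    left hJ hθ (cl J (x.cons β b) * v) = op v • left hJ hθ (cl J (x.cons β b)) := by
  let F : GPQ J →ₗ[k] T := left hJ hθ ∘ₗ LinearMap.mulLeft k (cl J (x.cons β b))
  let G : GPQ J →ₗ[k] T :=
    { toFun := fun v => op v • left hJ hθ (cl J (x.cons β b))
      map_add' := fun v w => by rw [MulOpposite.op_add, add_smul]
      map_smul' := fun t v => by rw [MulOpposite.op_smul, smul_assoc]; rfl }
  suffices h : F = G from LinearMap.congr_fun h v
  refine hom_ext fun l' m y => ?_
  change left hJ hθ (cl J (x.cons β b) * cl J y) = op (cl J y) • left hJ hθ (cl J (x.cons β b))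
  by_cases hl : l' = l
  · subst hl
    rw [← cl_mul, left_cl, left_cl, leftD_cons_mul]
  · have h1 : left hJ hθ (cl J (x.cons β b)) =
        op (ι J l 1) • left hJ hθ (cl J (x.cons β b)) := by
      rw [left_cl]
      conv_lhs => rw [← APath.mul_one' (x.cons β b), leftD_cons_mul]
      rfl
    rw [cl_mul_ne J hl, map_zero, h1, smul_smul, ← op_mul]
    have h2 : ι J l 1 * cl J y = 0 := cl_mul_ne J hl (APath.nil 1) y
    rw [h2, op_zero, zero_smul]

end LeftLift

/-! #### Splitting off the last entry -/

section Right

variable (J) in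
open Classical in
/-- The map `x β a ↦ a ⊗ (x β 1)`. -/
def rightD (l : V) {i : V} : ∀ {j : V}, APath A i j → (A l)ᵐᵒᵖ ⊗[k] GPQ J
  | _, .nil _ => 0
  -- The value `Pi.single j b l` is `b` when `j = l` and zero otherwise: only paths ending at `l`
  -- are recorded, and no transport along an equality of vertices is needed.
  | j, .cons x β b => op ((Pi.single j b : ∀ l, A l) l) ⊗ₜ cl J (x.cons β 1)

variable (J) in
/-- The linear extension of `rightD`. -/
def rightL (l : V) : GPA k A →ₗ[k] (A l)ᵐᵒᵖ ⊗[k] GPQ J :=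
  GPA.lift k (fun _ _ x => rightD J l x)
    (fun _ _ x y z h => by
      cases h with
      | nil => simp [rightD]
      | last => simp only [rightD, Pi.single_add, Pi.add_apply, MulOpposite.op_add, add_tmul]
      | cons h β c => simp only [rightD, cl_add J (APath.IsAdd.cons h β 1), tmul_add])
    (fun _ _ t x y h => by
      cases h with
      | nil => simp [rightD]
      | last => simp only [rightD, Pi.single_smul, Pi.smul_apply, MulOpposite.op_smul, smul_tmul']
      | cons h β c => simp only [rightD, cl_smul J (APath.IsSMul.cons h β 1), tmul_smul])

/-- A relation ends with the entry `1`, so the last entry of `u x w` comes from `w` alone. Splitting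
it off leaves a multiple of the relation in the other tensor factor, which vanishes in the quotient.
-/
theorem rightL_eq_zero (hJ : GPA.GeneratedBy I J) (l : V) : ∀ v ∈ J, rightL J l v = 0 := by
  classical
  refine hJ.map_eq_zero (rightL J l) fun i j ρ hρ x hx hsum i' j' u w => ?_
  have hof : ∀ {i j} (z : APath A i j), rightL J l (GPA.of k A z) = rightD J l z :=
    fun z => GPA.lift_of _ _ _ _ _
  simp only [hof]
  cases w with
  | nil c =>
    have h := congrArg (fun z => op ((Pi.single j c : ∀ l, A l) l) ⊗ₜ[k] z)
      (sum_mul_cl_eq_zero hsum u)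
    simp only [Finsupp.sum, tmul_sum, tmul_zero, tmul_smul] at h
    refine Eq.trans (Finset.sum_congr rfl fun p hp => ?_) h
    obtain ⟨m, y, γ, h⟩ := (hx p hp).2
    simp only [h, APath.mul, APath.rmul, rightD, one_mul]
  | cons w β b =>
    have h := congrArg (fun z => op ((Pi.single j' b : ∀ l, A l) l) ⊗ₜ[k] z)
      (sum_mul_cl_eq_zero (x := fun p => (x p).mul (w.cons β 1))
        (sum_cl_mul_eq_zero hsum (w.cons β 1)) u)
    simp only [Finsupp.sum, tmul_sum, tmul_zero, tmul_smul] at h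
    refine Eq.trans (Finset.sum_congr rfl fun p hp => ?_) h
    simp only [APath.mul, rightD]

/-- The map `x β a ↦ a ⊗ (x β 1)` on the quotient. -/
def right (hJ : GPA.GeneratedBy I J) (l : V) : GPQ J →ₗ[k] (A l)ᵐᵒᵖ ⊗[k] GPQ J :=
  lift (rightL J l) (rightL_eq_zero hJ l)

theorem right_nil (hJ : GPA.GeneratedBy I J) (l : V) {i : V} (a : A i) :
    right hJ l (cl J (.nil a)) = 0 :=
  (lift_cl _ _ _ _).trans (GPA.lift_of _ _ _ _ _)

theorem right_cons [DecidableEq V] (hJ : GPA.GeneratedBy I J) (l : V) {i j m : V} (x : APath A i j)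
    (β : j ⟶ m) (b : A m) : right hJ l (cl J (x.cons β b)) =
      op ((Pi.single m b : ∀ l, A l) l) ⊗ₜ cl J (x.cons β 1) :=
  (lift_cl _ _ _ _).trans ((GPA.lift_of _ _ _ _ _).trans (by rw [rightD]; congr!))

theorem right_mul_ι (hJ : GPA.GeneratedBy I J) (l : V) (v : GPQ J) (a : A l) :
    right hJ l (v * ι J l a) = op a • right hJ l v := by
  classical
  let F : GPQ J →ₗ[k] (A l)ᵐᵒᵖ ⊗[k] GPQ J := right hJ l ∘ₗ LinearMap.mulRight k (ι J l a)
  let G : GPQ J →ₗ[k] (A l)ᵐᵒᵖ ⊗[k] GPQ J :=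
    { toFun := fun v => op a • right hJ l v
      map_add' := fun v w => by rw [map_add, smul_add]
      map_smul' := fun t v => by rw [map_smul, smul_comm]; rfl }
  suffices h : F = G from LinearMap.congr_fun h v
  refine hom_ext fun i j x => ?_
  change right hJ l (cl J x * cl J (.nil a)) = op a • right hJ l (cl J x)
  by_cases hl : l = j
  · subst hl
    rw [← cl_mul]
    cases x with
    | nil b => rw [APath.mul, APath.rmul, right_nil, right_nil, smul_zero]
    | cons x β b =>
      rw [APath.mul, APath.rmul, right_cons, right_cons, smul_tmul', smul_eq_mul, ← op_mul,
        Pi.single_eq_same, Pi.single_eq_same]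
  · rw [cl_mul_ne J hl, map_zero]
    cases x with
    | nil b => rw [right_nil, smul_zero]
    | cons x β b => rw [right_cons, Pi.single_eq_of_ne hl, op_zero, zero_tmul, smul_zero]

end Right

end GPQ

end

end

/-! ### The extension of `A i` by `N_i ⊗ A i` -/

section

open TensorProduct MulOpposite

noncomputable section

namespace GPQ

variable {k : Type u} [Field k] {V : Type u} [Quiver.{u} V] {A : V → Type u}
  [∀ i, Ring (A i)] [∀ i, Algebra k (A i)] [Fintype V]
  {I : ∀ i j : V, Set (Quiver.Path i j →₀ k)} (J : TwoSidedIdeal (GPA k A))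

/-- The right ideal generated by the arrows which start at a given vertex. -/
def arrowModule (i : V) : Submodule (GPQ J)ᵐᵒᵖ (GPQ J) :=
  Submodule.span (GPQ J)ᵐᵒᵖ {v | ∃ (m : V) (γ : i ⟶ m), v = ar J γ}

variable {J}

theorem ar_mem {i m : V} (γ : i ⟶ m) : ar J γ ∈ arrowModule J i :=
  Submodule.subset_span ⟨m, γ, rfl⟩

theorem ι_mul_ar {i m : V} (γ : i ⟶ m) : ι J i 1 * ar J γ = ar J γ := ι_one_mul J _

theorem ι_mul_ar_ne {i l m : V} (h : l ≠ i) (a : A i) (γ : l ⟶ m) : ι J i a * ar J γ = 0 :=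
  cl_mul_ne J h _ _

theorem ι_mul_ar_mem (i : V) {l m : V} (γ : l ⟶ m) : ι J i 1 * ar J γ ∈ arrowModule J i := by
  by_cases h : l = i
  · subst h
    rw [ι_mul_ar]
    exact ar_mem γ
  · rw [ι_mul_ar_ne h]
    exact zero_mem _

theorem ar_mul_mem {i m : V} (γ : i ⟶ m) (v : GPQ J) : ar J γ * v ∈ arrowModule J i :=
  (arrowModule J i).smul_mem (op v) (ar_mem γ)

theorem mem_arrowModule_induction {i : V} {p : ∀ v, v ∈ arrowModule J i → Prop}
    (mul : ∀ (m : V) (γ : i ⟶ m) (v : GPQ J), p (ar J γ * v) (ar_mul_mem γ v))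
    (zero : p 0 (zero_mem _))
    (add : ∀ v w hv hw, p v hv → p w hw → p (v + w) (add_mem hv hw))
    {v : GPQ J} (hv : v ∈ arrowModule J i) : p v hv := by
  induction hv using Submodule.closure_induction with
  | zero => exact zero
  | add x y hx' hy' hx hy => exact add x y _ _ hx hy
  | smul_mem r x hx =>
    obtain ⟨m, γ, rfl⟩ := hx
    exact mul m γ r.unop

theorem ι_one_mul_of_mem {i : V} {v : GPQ J} (hv : v ∈ arrowModule J i) : ι J i 1 * v = v := by
  induction hv using mem_arrowModule_induction with
  | mul m γ v => rw [← mul_assoc, ι_mul_ar]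
  | zero => rw [mul_zero]
  | add v w _ _ hv hw => rw [mul_add, hv, hw]

-- The retraction expresses elements of the submodule as linear functions of elements of the
-- algebra, so linear identities transfer to it without tracking membership.
variable (J) in
theorem exists_retr (i : V) : ∃ r : GPQ J →ₗ[k] arrowModule J i,
    ∀ n : arrowModule J i, r (n : GPQ J) = n := by
  obtain ⟨r, hr⟩ := LinearMap.exists_leftInverse_of_injective
    ((arrowModule J i).subtype.restrictScalars k)
    (LinearMap.ker_eq_bot_of_injective Subtype.val_injective)
  exact ⟨r, LinearMap.congr_fun hr⟩

variable (J) in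
/-- A linear retraction onto the right ideal generated by the arrows starting at a vertex. -/
def retr (i : V) : GPQ J →ₗ[k] arrowModule J i := (exists_retr J i).choose

theorem retr_coe {i : V} (n : arrowModule J i) : retr J i (n : GPQ J) = n :=
  (exists_retr J i).choose_spec n

open Classical in
variable (J) in
/-- The map `a γ ↦ γ ⊗ a` for arrows `γ` starting at the vertex `i`. -/
def coneθ (i : V) (l m : V) (γ : l ⟶ m) : A l →ₗ[k] arrowModule J i ⊗[k] (A i)ᵐᵒᵖ :=
  TensorProduct.mk k (arrowModule J i) (A i)ᵐᵒᵖ ⟨ι J i 1 * ar J γ, ι_mul_ar_mem i γ⟩ ∘ₗ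
    (opLinearEquiv k).toLinearMap ∘ₗ LinearMap.proj i ∘ₗ LinearMap.single k A l

open Classical in
theorem coneθ_apply {i l m : V} (γ : l ⟶ m) (a : A l) : coneθ J i l m γ a =
    (⟨ι J i 1 * ar J γ, ι_mul_ar_mem i γ⟩ : arrowModule J i) ⊗ₜ
      op ((Pi.single l a : ∀ l, A l) i) := rfl

open Classical in
theorem smul_coneθ {i l m : V} (γ : l ⟶ m) (a : A l) (v : GPQ J) : op v • coneθ J i l m γ a =
    retr J i (ι J i 1 * (ar J γ * v)) ⊗ₜ op ((Pi.single l a : ∀ l, A l) i) := by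
  rw [coneθ_apply, smul_tmul']
  congr 1
  rw [← retr_coe (op v • (⟨ι J i 1 * ar J γ, ι_mul_ar_mem i γ⟩ : arrowModule J i))]
  congr 1
  exact mul_assoc _ _ _

/-- Since relations begin with the entry `1`, moving the first entry `a` into the second tensor
factor leaves the relation itself in the first, where it is zero. This is why the kernel of `e_i Λ →
A i` is `N_i ⊗ A i`, with no further relations. -/
theorem coneθ_respects (i : V) :
    Respects (J := J) (T := arrowModule J i ⊗[k] (A i)ᵐᵒᵖ) (coneθ J i) I := by
  classical
  intro l j ρ _ x hx hsum a
  have h : (ρ.sum fun p t => t • (retr J i (ι J i 1 * cl J (x p)) ⊗ₜ[k]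
      op ((Pi.single l a : ∀ l, A l) i))) = 0 := by
    have h1 := congrArg (fun z => retr J i (ι J i 1 * z) ⊗ₜ[k]
      op ((Pi.single l a : ∀ l, A l) i)) hsum
    simpa only [Finsupp.sum, Finset.mul_sum, map_sum, sum_tmul, mul_smul_comm, map_smul,
      ← smul_tmul', mul_zero, map_zero, zero_tmul] using h1
  refine Eq.trans (Finset.sum_congr rfl fun p hp => ?_) h
  obtain ⟨m, γ, w, h⟩ := hx p hp
  change ρ p • _ = ρ p • _
  rw [h, APath.nil_mul_cons_mul, leftD_mul, smul_coneθ, mul_one, cl_mul]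
  rfl

section

variable (hJ : GPA.GeneratedBy I J) (i : V)

/-- The derivation `a γ w ↦ (γ w) ⊗ a`. -/
def coneD : GPQ J →ₗ[k] arrowModule J i ⊗[k] (A i)ᵐᵒᵖ := left hJ (coneθ_respects i)

open Classical in
theorem coneD_mul {l m j : V} (γ : l ⟶ m) (a : A l) (w : APath A m j) :
    coneD hJ i (cl J (((APath.nil a).cons γ 1).mul w)) =
      retr J i (ι J i 1 * (ar J γ * cl J w)) ⊗ₜ op ((Pi.single l a : ∀ l, A l) i) := by
  rw [coneD, left_mul, smul_coneθ]

theorem coneD_nil {l : V} (a : A l) : coneD hJ i (cl J (.nil a)) = 0 := left_nil hJ _ a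

/-- The Leibniz rule `D(vw) = D(v) w + π(v) D(w)`. For a path `v` of positive length `π v = 0` and
`D` is right linear; for `v` of length zero `D v = 0` and only the first entry of `w` is multiplied.
-/
theorem coneD_mul_rule (v w : GPQ J) : coneD hJ i (v * w) = op w • coneD hJ i v +
    LinearMap.lTensor (arrowModule J i) (LinearMap.mulRight k (op (π hJ i v))) (coneD hJ i w) := by
  classical
  let F : GPQ J →ₗ[k] arrowModule J i ⊗[k] (A i)ᵐᵒᵖ := coneD hJ i ∘ₗ LinearMap.mulRight k w
  let G : GPQ J →ₗ[k] arrowModule J i ⊗[k] (A i)ᵐᵒᵖ :=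
    { toFun := fun v => op w • coneD hJ i v +
        LinearMap.lTensor (arrowModule J i) (LinearMap.mulRight k (op (π hJ i v))) (coneD hJ i w)
      map_add' := fun v v' => by
        have h : LinearMap.mulRight k (op (π hJ i (v + v'))) =
            LinearMap.mulRight k (op (π hJ i v)) + LinearMap.mulRight k (op (π hJ i v')) := by
          rw [map_add, MulOpposite.op_add]; ext; simp [mul_add]
        rw [h, LinearMap.lTensor_add, LinearMap.add_apply, map_add, smul_add]; abel
      map_smul' := fun t v => by
        have h : LinearMap.mulRight k (op (π hJ i (t • v))) =
            t • LinearMap.mulRight k (op (π hJ i v)) := by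
          rw [map_smul, MulOpposite.op_smul]; ext; simp
        rw [h, LinearMap.lTensor_smul, LinearMap.smul_apply, map_smul, RingHom.id_apply, smul_add,
          smul_comm] }
  suffices h : F = G from LinearMap.congr_fun h v
  refine hom_ext (W := arrowModule J i ⊗[k] (A i)ᵐᵒᵖ) fun l j x => ?_
  change coneD hJ i (cl J x * w) = op w • coneD hJ i (cl J x) +
    LinearMap.lTensor (arrowModule J i) (LinearMap.mulRight k (op (π hJ i (cl J x)))) (coneD hJ i w)
  cases x with
  | cons x β b =>
    have h : LinearMap.mulRight k (0 : (A i)ᵐᵒᵖ) = 0 := by ext; simp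
    rw [π_cons, op_zero, h, LinearMap.lTensor_zero, LinearMap.zero_apply, add_zero]
    exact left_cons_mul hJ _ x β b w
  | nil a =>
    rw [coneD_nil, smul_zero, zero_add]
    suffices h : coneD hJ i ∘ₗ LinearMap.mulLeft k (cl J (.nil a)) =
        LinearMap.lTensor (arrowModule J i) (LinearMap.mulRight k (op (π hJ i (cl J (.nil a))))) ∘ₗ
          coneD hJ i from LinearMap.congr_fun h w
    refine hom_ext (W := arrowModule J i ⊗[k] (A i)ᵐᵒᵖ) fun p q y => ?_
    change coneD hJ i (cl J (.nil a) * cl J y) = LinearMap.lTensor (arrowModule J i)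
      (LinearMap.mulRight k (op (π hJ i (cl J (.nil a))))) (coneD hJ i (cl J y))
    rw [π_nil]
    by_cases hp : p = l
    · subst hp
      rw [← cl_mul]
      refine APath.left_cases (fun b => ?_) (fun m γ b j w => ?_) y
      · rw [APath.mul, APath.rmul, coneD_nil, coneD_nil, map_zero]
      · rw [APath.nil_mul_cons_mul, coneD_mul, coneD_mul, LinearMap.lTensor_tmul,
          LinearMap.mulRight_apply, ← op_mul, Pi.single_mul, Pi.mul_apply]
    · rw [cl_mul_ne J hp, map_zero]
      refine APath.left_cases (fun b => ?_) (fun m γ b j w => ?_) y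
      · rw [coneD_nil, map_zero]
      · rw [coneD_mul, LinearMap.lTensor_tmul, LinearMap.mulRight_apply, ← op_mul, ← Pi.mul_apply]
        have h : (Pi.single l a * Pi.single p b : ∀ l, A l) = 0 := by
          ext s
          by_cases hs : s = l
          · subst hs; simp [Pi.single_eq_of_ne (Ne.symm hp)]
          · simp [Pi.single_eq_of_ne hs]
        rw [h, Pi.zero_apply, op_zero, tmul_zero]

theorem π_of_mem {v : GPQ J} (hv : v ∈ arrowModule J i) (j : V) : π hJ j v = 0 := by
  induction hv using mem_arrowModule_induction with
  | mul m γ v => rw [map_mul, ar, π_cons, zero_mul]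
  | zero => rw [map_zero]
  | add v w _ _ hv hw => rw [map_add, hv, hw, add_zero]

theorem coneD_coe (n : arrowModule J i) : coneD hJ i (n : GPQ J) = n ⊗ₜ 1 := by
  classical
  suffices h : ∀ v ∈ arrowModule J i, coneD hJ i v = retr J i v ⊗ₜ 1 by
    rw [h _ n.2, retr_coe]
  intro v hv
  induction hv using mem_arrowModule_induction with
  | mul m γ v =>
    rw [ar, coneD, left_cons_mul, ← coneD]
    have h := coneD_mul hJ i γ (1 : A i) (APath.nil (1 : A m))
    rw [APath.mul_one'] at h
    have h1 : ar J γ * cl J (.nil 1) = ar J γ := mul_ι_one J _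
    rw [h, h1, ι_mul_ar, Pi.single_eq_same, smul_tmul', op_one]
    congr 1
    have h2 := retr_coe (⟨ar J γ, ar_mem γ⟩ : arrowModule J i)
    rw [h2, ← retr_coe (op v • _)]
    rfl
  | zero => rw [map_zero, map_zero, zero_tmul]
  | add v w _ _ hv hw => rw [map_add, map_add, hv, hw, add_tmul]

variable (J) in
/-- The inclusion of the algebra at a vertex, as a linear map between the opposite algebras. -/
def ιop : (A i)ᵐᵒᵖ →ₗ[k] (GPQ J)ᵐᵒᵖ :=
  (opLinearEquiv k).toLinearMap ∘ₗ ι J i ∘ₗ (opLinearEquiv k).symm.toLinearMap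

variable (J) in
/-- The inclusion of the right ideal generated by the arrows starting at a vertex. -/
def νop : arrowModule J i →ₗ[(GPQ J)ᵐᵒᵖ] (GPQ J)ᵐᵒᵖ where
  toFun n := op (n : GPQ J)
  map_add' _ _ := rfl
  map_smul' _ _ := rfl

/-- An element of `e_i Λ` is the sum of its length-zero part and the part rebuilt from `D`, where
the split-off first entry is multiplied back on the left. -/
theorem op_ι_mul (a : A i) (v : GPQ J) : op (ι J i a * v) = op (ι J i (a * π hJ i v)) +
    TensorProduct.lift ((LinearMap.mul k (GPQ J)ᵐᵒᵖ).compl₁₂ ((νop J i).restrictScalars k)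
      (ιop J i))
        (LinearMap.lTensor (arrowModule J i) (LinearMap.mulRight k (op a)) (coneD hJ i v)) := by
  classical
  let F : GPQ J →ₗ[k] (GPQ J)ᵐᵒᵖ := (opLinearEquiv k).toLinearMap ∘ₗ LinearMap.mulLeft k (ι J i a)
  let G : GPQ J →ₗ[k] (GPQ J)ᵐᵒᵖ :=
    (opLinearEquiv k).toLinearMap ∘ₗ ι J i ∘ₗ LinearMap.mulLeft k a ∘ₗ (π hJ i).toLinearMap +
    TensorProduct.lift ((LinearMap.mul k (GPQ J)ᵐᵒᵖ).compl₁₂ ((νop J i).restrictScalars k)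
      (ιop J i)) ∘ₗ LinearMap.lTensor (arrowModule J i) (LinearMap.mulRight k (op a)) ∘ₗ coneD hJ i
  suffices h : F = G from LinearMap.congr_fun h v
  refine hom_ext fun l j x => ?_
  change op (ι J i a * cl J x) = op (ι J i (a * π hJ i (cl J x))) +
    TensorProduct.lift ((LinearMap.mul k (GPQ J)ᵐᵒᵖ).compl₁₂ ((νop J i).restrictScalars k)
      (ιop J i))
        (LinearMap.lTensor (arrowModule J i) (LinearMap.mulRight k (op a)) (coneD hJ i (cl J x)))
  refine APath.left_cases (fun b => ?_) (fun m γ b j w => ?_) x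
  · rw [coneD_nil, map_zero, map_zero, add_zero, π_nil]
    by_cases h : i = l
    · subst h
      rw [Pi.single_eq_same, ι_mul]
      rfl
    · rw [Pi.single_eq_of_ne h, mul_zero, map_zero]
      exact congrArg op (cl_mul_ne J (Ne.symm h) _ _)
  · have hπ : π hJ i (cl J (((APath.nil b).cons γ 1).mul w)) = 0 := by
      rw [cl_mul, map_mul, π_cons, zero_mul]
    rw [hπ, mul_zero, map_zero, op_zero, zero_add, coneD_mul, LinearMap.lTensor_tmul,
      TensorProduct.lift.tmul, LinearMap.mulRight_apply, ← op_mul]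
    change _ = op (ι J i (a * (Pi.single l b : ∀ l, A l) i) *
      ((retr J i (ι J i 1 * (ar J γ * cl J w)) : arrowModule J i) : GPQ J))
    congr 1
    by_cases h : i = l
    · subst h
      have h2 := retr_coe (⟨ar J γ * cl J w, ar_mul_mem γ _⟩ : arrowModule J i)
      rw [← mul_assoc (ι J i 1), ι_mul_ar, h2, Pi.single_eq_same, cl_eq_ι_mul, ι_mul]
      simp only [mul_assoc]
    · rw [Pi.single_eq_of_ne h, mul_zero, map_zero, zero_mul, cl_eq_ι_mul, ← mul_assoc, ← mul_assoc,
        ι_mul_ι_ne J (Ne.symm h), zero_mul, zero_mul]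

/-- The cone datum which exhibits the projective module over a vertex as an extension. -/
def coneData : ConeData k (GPQ J)ᵐᵒᵖ (A i)ᵐᵒᵖ (arrowModule J i) where
  π := (π hJ i).op
  D := coneD hJ i ∘ₗ (opLinearEquiv k).symm.toLinearMap
  ι := ιop J i
  ν := νop J i
  D_mul r s := coneD_mul_rule hJ i s.unop r.unop
  π_ι b := congrArg op (π_ι hJ i b.unop)
  D_ι b := coneD_nil hJ i b.unop
  π_ν n := congrArg op (π_of_mem hJ i n.2 i)
  D_ν n := coneD_coe hJ i n
  mul_ι r b := op_ι_mul hJ i b.unop r.unop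

end

end GPQ

end

end

/-! ### Corners of `Λ` and of `N_i` over the vertex algebras -/

section

open TensorProduct MulOpposite

noncomputable section

namespace GPQ

variable {k : Type u} [Field k] {V : Type u} [Quiver.{u} V] {A : V → Type u}
  [∀ i, Ring (A i)] [∀ i, Algebra k (A i)] [Fintype V]
  {I : ∀ i j : V, Set (Quiver.Path i j →₀ k)} (J : TwoSidedIdeal (GPA k A))

variable {J} in
theorem cl_induction {p : GPQ J → Prop} (zero : p 0) (add : ∀ v w, p v → p w → p (v + w))
    (cl : ∀ (i j : V) (x : APath A i j), p (cl J x)) (v : GPQ J) : p v := by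
  obtain ⟨v, rfl⟩ := mk_surjective J v
  obtain ⟨v, rfl⟩ := Submodule.mkQ_surjective (multilinearRel k A) v
  change p (mk J (GPA.proj k A v))
  induction v using Finsupp.induction_linear with
  | zero => simpa using zero
  | add v w hv hw => rw [map_add, map_add]; exact add _ _ hv hw
  | single x t =>
    obtain ⟨i, j, x⟩ := x
    -- A scalar is absorbed into the last entry, so sums of classes of paths already exhaust the
    -- quotient.
    have h : APath.IsSMul t (x.rmul (t • 1)) x := by
      cases x with
      | nil a => simpa [APath.rmul] using APath.IsSMul.nil (t := t) a
      | cons x β a => simpa [APath.rmul] using APath.IsSMul.last (t := t) x β a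
    have h1 : (Finsupp.single ⟨i, j, x⟩ t : FreeAPath k A) = t • FreeAPath.single k A x := by
      rw [Finsupp.smul_single, smul_eq_mul, mul_one]
    rw [h1, map_smul, map_smul]
    have h2 := cl i j (x.rmul (t • 1))
    rw [cl_smul J h] at h2
    exact h2

/-- The inclusion of the algebra at a vertex, as a ring homomorphism which does not preserve `1`. -/
def φ (j : V) : (A j)ᵐᵒᵖ →ₙ+* (GPQ J)ᵐᵒᵖ where
  toFun b := op (ι J j b.unop)
  map_mul' a b := by rw [unop_mul, ι_mul, op_mul]
  map_zero' := congrArg op (map_zero (ι J j))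
  map_add' a b := congrArg op (map_add (ι J j) a.unop b.unop)

theorem φ_op (j : V) (a : A j) : φ J j (op a) = op (ι J j a) := rfl

theorem φ_one (j : V) : φ J j 1 = op (ι J j 1) := rfl

section

variable {X : Type u} [AddCommGroup X] [Module (GPQ J)ᵐᵒᵖ X]

theorem proj_smul_ι (j : V) {l : V} [DecidableEq V] (b : A l) (x : X) :
    Corner.proj (φ J j) (op (ι J l b) • x) =
      Corner.proj (φ J j) (op (ι J j ((Pi.single l b : ∀ l, A l) j)) • x) := by
  by_cases h : j = l
  · subst h; rw [Pi.single_eq_same]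
  · rw [Pi.single_eq_of_ne h, map_zero, op_zero, zero_smul, map_zero]
    refine Subtype.ext ?_
    change op (ι J j 1) • op (ι J l b) • x = 0
    rw [smul_smul, ← op_mul, ι_mul_ι_ne J h, op_zero, zero_smul]

variable [Module k X] [IsScalarTower k (GPQ J)ᵐᵒᵖ X] (r : GPQ J →ₗ[k] X) (j : V)

/-- The map `a ⊗ v ↦ r(v) a`. -/
def cmul : (A j)ᵐᵒᵖ ⊗[k] GPQ J →ₗ[(A j)ᵐᵒᵖ] Corner (φ J j) X where
  toFun t := Corner.proj (φ J j) (TensorProduct.lift (LinearMap.mk₂ k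
    (fun (b : (A j)ᵐᵒᵖ) v => φ J j b • r v)
    (fun a b v => by rw [map_add, add_smul])
    (fun t b v => by
      rw [← smul_assoc]
      exact congrArg (fun z => op z • r v) (map_smul (ι J j) t b.unop))
    (fun b v w => by rw [map_add, smul_add])
    (fun t b v => by rw [map_smul, smul_comm])) t)
  map_add' s t := by rw [map_add, map_add]
  map_smul' b t := by
    rw [RingHom.id_apply, ← Corner.proj_smul]
    congr 1
    induction t using TensorProduct.induction_on with
    | zero => simp
    | tmul c v => simp [smul_tmul', mul_smul]
    | add s t hs ht => simp only [smul_add, map_add, hs, ht]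

theorem cmul_tmul (a : A j) (v : GPQ J) :
    cmul J r j (op a ⊗ₜ v) = Corner.proj (φ J j) (op (ι J j a) • r v) := rfl

end

variable {J} (hJ : GPA.GeneratedBy I J) (j : V)

/-- An element of `Λ e_j` is its length-zero part plus the part obtained by multiplying the
split-off last entries back on. -/
theorem proj_op (v : GPQ J) : Corner.proj (φ J j) (op v) =
    Corner.proj (φ J j) (op (ι J j (π hJ j v))) +
      cmul J (opLinearEquiv k).toLinearMap j (right hJ j v) := by
  classical
  induction v using cl_induction with
  | zero => simp
  | add v w hv hw => simp only [map_add, MulOpposite.op_add, hv, hw]; abel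
  | cl i l x =>
    cases x with
    | nil a =>
      rw [π_nil, right_nil, map_zero, add_zero]
      have h := proj_smul_ι J j a (1 : (GPQ J)ᵐᵒᵖ)
      simp only [smul_eq_mul, mul_one] at h
      exact h
    | cons x β b =>
      rw [π_cons, right_cons, cmul_tmul, map_zero, op_zero, map_zero, zero_add, cl_cons,
        op_mul]
      exact proj_smul_ι J j b (op (cl J (x.cons β 1)))

/-- Elements of `N_i` have no length-zero part. Replacing the last entry of a path in `N_i` by `1`
yields a path that is again in `N_i`, so the reassembly takes place inside `N_i`. -/
theorem cmul_retr {i : V} (n : arrowModule J i) :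
    cmul J (retr J i) j (right hJ j (n : GPQ J)) = Corner.proj (φ J j) n := by
  classical
  suffices h : ∀ v, ∀ hv : v ∈ arrowModule J i,
      cmul J (retr J i) j (right hJ j v) = Corner.proj (φ J j) ⟨v, hv⟩ from h n n.2
  intro v hv
  induction hv using mem_arrowModule_induction with
  | zero =>
    rw [map_zero, map_zero]
    exact (map_zero (Corner.proj (φ J j))).symm
  | add v w hv' hw' hv hw =>
    rw [map_add, map_add, hv, hw, ← map_add]
    rfl
  | mul m γ v =>
    have key : ∀ (l : V) (y : APath A i l) (q : V) (δ : l ⟶ q) (b : A q)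
        (h1 : cl J (y.cons δ 1) ∈ arrowModule J i) (h : cl J (y.cons δ b) ∈ arrowModule J i),
        cmul J (retr J i) j (right hJ j (cl J (y.cons δ b))) =
          Corner.proj (φ J j) ⟨cl J (y.cons δ b), h⟩ := by
      intro l y q δ b h1 h
      have h2 := retr_coe (⟨cl J (y.cons δ 1), h1⟩ : arrowModule J i)
      have h3 : (⟨cl J (y.cons δ b), h⟩ : arrowModule J i) =
          op (ι J q b) • (⟨cl J (y.cons δ 1), h1⟩ : arrowModule J i) :=
        Subtype.ext (cl_cons J y δ b)
      rw [right_cons, cmul_tmul, h2, h3, ← proj_smul_ι]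
    suffices h : ∀ v : GPQ J, cmul J (retr J i) j (right hJ j (ar J γ * v)) =
        Corner.proj (φ J j) ⟨ar J γ * v, ar_mul_mem γ v⟩ from h v
    intro v
    induction v using cl_induction with
    | zero =>
      simp only [mul_zero, map_zero]
      exact (map_zero (Corner.proj (φ J j))).symm
    | add v w hv hw =>
      simp only [mul_add, map_add, hv, hw]
      exact (map_add (Corner.proj (φ J j)) _ _).symm
    | cl p q w =>
      by_cases hp : p = m
      · subst hp
        have h0 := ar_mul_mem (J := J) γ (cl J w)
        have h1 : ar J γ * cl J w = cl J (((APath.nil 1).cons γ 1).mul w) := (cl_mul J _ _).symm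
        suffices h : ∀ h, cmul J (retr J i) j (right hJ j (cl J (((APath.nil 1).cons γ 1).mul w))) =
            Corner.proj (φ J j) (⟨cl J (((APath.nil 1).cons γ 1).mul w), h⟩ : arrowModule J i) by
          simpa only [h1] using h (h1 ▸ h0)
        intro h
        cases w with
        | nil b => exact key _ _ _ _ _ (ar_mem γ) h
        | cons w δ b =>
          refine key _ _ _ _ _ ?_ h
          have h2 := ar_mul_mem (J := J) γ (cl J (w.cons δ 1))
          rwa [ar, ← cl_mul] at h2
      · have h1 : ar J γ * cl J w = 0 := cl_mul_ne J hp _ _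
        simp only [h1, map_zero]
        exact (map_zero (Corner.proj (φ J j))).symm

/-- The map `v ↦ (v e_j e_j, right v)` on the part of the algebra ending at `j`. -/
def cornerMap : Corner (φ J j) (GPQ J)ᵐᵒᵖ →ₗ[(A j)ᵐᵒᵖ]
    (A j)ᵐᵒᵖ × ((A j)ᵐᵒᵖ ⊗[k] GPQ J) where
  toFun v := (op (π hJ j (unop (v : (GPQ J)ᵐᵒᵖ))), right hJ j (unop (v : (GPQ J)ᵐᵒᵖ)))
  map_add' v w := by simp
  map_smul' b v := by
    refine Prod.ext ?_ (right_mul_ι hJ j _ b.unop)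
    change op (π hJ j (unop (v : (GPQ J)ᵐᵒᵖ) * ι J j b.unop)) = _
    rw [map_mul, π_ι]
    rfl

variable (J) in
/-- The inverse on the left of `cornerMap`. -/
def cornerInv : (A j)ᵐᵒᵖ × ((A j)ᵐᵒᵖ ⊗[k] GPQ J) →ₗ[(A j)ᵐᵒᵖ] Corner (φ J j) (GPQ J)ᵐᵒᵖ :=
  LinearMap.coprod (LinearMap.toSpanSingleton _ _ (Corner.proj (φ J j) 1))
    (cmul J (opLinearEquiv k).toLinearMap j)

theorem cornerInv_comp_cornerMap : cornerInv J j ∘ₗ cornerMap hJ j = LinearMap.id := by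
  refine LinearMap.ext fun v => ?_
  rw [LinearMap.id_apply, ← Corner.proj_coe (φ J j) v]
  refine Eq.trans ?_ (proj_op hJ j (unop (v : (GPQ J)ᵐᵒᵖ))).symm
  rw [Corner.proj_coe]
  change op (π hJ j (unop (v : (GPQ J)ᵐᵒᵖ))) • Corner.proj (φ J j) (1 : (GPQ J)ᵐᵒᵖ) + _ = _
  rw [← Corner.proj_smul, φ_op, smul_eq_mul, mul_one]
  rfl

/-- Splitting off the last entry makes `Λ e_j` a retract of `A j ⊕ (A j ⊗ Λ)`, which is free over `A
j` because `Λ` is a vector space. -/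
theorem corner_projective (hJ : GPA.GeneratedBy I J) :
    Module.Projective (A j)ᵐᵒᵖ (Corner (φ J j) (GPQ J)ᵐᵒᵖ) :=
  Module.Projective.of_split (cornerMap hJ j) (cornerInv J j) (cornerInv_comp_cornerMap hJ j)

theorem corner_finite (hJ : GPA.GeneratedBy I J) [Module.Finite k (A j)] [Module.Finite k (GPQ J)] :
    Module.Finite (A j)ᵐᵒᵖ (Corner (φ J j) (GPQ J)ᵐᵒᵖ) := by
  have : Module.Finite k (A j)ᵐᵒᵖ := Module.Finite.equiv (opLinearEquiv k)
  have : Module.Finite (A j)ᵐᵒᵖ ((A j)ᵐᵒᵖ ⊗[k] GPQ J) :=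
    Module.Finite.of_restrictScalars_finite k _ _
  refine Module.Finite.of_surjective (cornerInv J j) fun v => ⟨cornerMap hJ j v, ?_⟩
  exact LinearMap.congr_fun (cornerInv_comp_cornerMap hJ j) v

/-- The map `right` on the part of `arrowModule J i` ending at `j`. -/
def arrowCornerMap (i : V) : Corner (φ J j) (arrowModule J i) →ₗ[(A j)ᵐᵒᵖ]
    (A j)ᵐᵒᵖ ⊗[k] GPQ J where
  toFun n := right hJ j ((n : arrowModule J i) : GPQ J)
  map_add' v w := by simp
  map_smul' b v := right_mul_ι hJ j _ b.unop

theorem cmul_comp_arrowCornerMap (i : V) :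
    cmul J (retr J i) j ∘ₗ arrowCornerMap hJ j i = LinearMap.id :=
  LinearMap.ext fun n => (cmul_retr hJ j (n : arrowModule J i)).trans (Corner.proj_coe (φ J j) n)

theorem arrowCorner_projective (hJ : GPA.GeneratedBy I J) (i : V) :
    Module.Projective (A j)ᵐᵒᵖ (Corner (φ J j) (arrowModule J i)) :=
  Module.Projective.of_split (arrowCornerMap hJ j i) (cmul J (retr J i) j)
    (cmul_comp_arrowCornerMap hJ j i)

theorem arrowCorner_finite (hJ : GPA.GeneratedBy I J) (i : V) [Module.Finite k (A j)]
    [Module.Finite k (GPQ J)] :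
    Module.Finite (A j)ᵐᵒᵖ (Corner (φ J j) (arrowModule J i)) := by
  have : Module.Finite k (A j)ᵐᵒᵖ := Module.Finite.equiv (opLinearEquiv k)
  have : Module.Finite (A j)ᵐᵒᵖ ((A j)ᵐᵒᵖ ⊗[k] GPQ J) :=
    Module.Finite.of_restrictScalars_finite k _ _
  exact Module.Finite.of_surjective (cmul J (retr J i) j) fun n =>
    ⟨arrowCornerMap hJ j i n, LinearMap.congr_fun (cmul_comp_arrowCornerMap hJ j i) n⟩

/-- The relation that there is a path of positive length from `j` to `i`. -/
def IsSucc (V : Type u) [Quiver.{u} V] (j i : V) : Prop := ∃ p : Quiver.Path i j, 0 < p.length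

theorem isSucc_wellFounded (hV : ∀ (i : V) (p : Quiver.Path i i), p.length = 0) :
    WellFounded (IsSucc V) ∧ WellFounded (fun i j => IsSucc V j i) := by
  have h1 : IsTrans V (IsSucc V) := ⟨fun a b c ⟨p, hp⟩ ⟨q, hq⟩ => ⟨q.comp p, by
    rw [Quiver.Path.length_comp]; omega⟩⟩
  have h2 : Std.Irrefl (IsSucc V) := ⟨fun a ⟨p, hp⟩ => by rw [hV a p] at hp; exact hp.false⟩
  have h3 : IsTrans V (fun i j => IsSucc V j i) := ⟨fun a b c hp hq => h1.trans _ _ _ hq hp⟩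
  have h4 : Std.Irrefl (fun i j => IsSucc V j i) := ⟨h2.irrefl⟩
  exact ⟨Finite.wellFounded_of_trans_of_irrefl _, Finite.wellFounded_of_trans_of_irrefl _⟩

/-- The underlying path of an `𝒜`-path. -/
def _root_.APath.path {i : V} : ∀ {j : V}, APath A i j → Quiver.Path i j
  | _, .nil _ => .nil
  | _, .cons x β _ => (APath.path x).cons β

theorem pdLT_of_corners (hJ : GPA.GeneratedBy I J)
    (hV : ∀ (i : V) (p : Quiver.Path i i), p.length = 0) {n : ℕ} (M : Type u) [AddCommGroup M]
    [Module (GPQ J)ᵐᵒᵖ M]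
    (h : ∀ j, PdLT (GPQ J)ᵐᵒᵖ (Infl (coneData hJ j).π.toRingHom (Corner (φ J j) M)) n) :
    PdLT (GPQ J)ᵐᵒᵖ M n := by
  classical
  -- The order puts `i` below `j` when a path of positive length leads from `i` to `j`, so a minimal
  -- vertex receives no path from the others. Acyclicity gives well-foundedness and `e_j Λ e_j = A
  -- j`.
  refine PdLT.of_corners (fun j => (coneData hJ j).π.toRingHom) (φ J) (fun i j => IsSucc V j i)
    (isSucc_wellFounded hV).2 ?_ (fun j l hl => ?_) (fun j r => ?_) (fun j l r hl hlt => ?_) M h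
  · simp only [φ_one, ← Finset.op_sum]
    exact congrArg op (one_eq J).symm
  · rw [φ_one, φ_one, ← op_mul, ι_mul_ι_ne J (Ne.symm hl), op_zero]
  · rw [φ_one]
    change op (ι J j 1 * (r.unop * ι J j 1)) = op (ι J j (π hJ j r.unop))
    congr 1
    generalize r.unop = v
    induction v using cl_induction with
    | zero => simp
    | add v w hv hw => simp only [add_mul, mul_add, map_add, hv, hw]
    | cl l m x =>
      by_cases hl : l = j
      · subst hl
        by_cases hm : m = l
        · subst hm
          rw [mul_ι_one, ι_one_mul]
          cases x with
          | nil a => rw [π_nil, Pi.single_eq_same]; rfl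
          | cons x β b => exact absurd (hV _ (x.cons β b).path) (by simp [APath.path])
        · have h0 : cl J x * ι J l 1 = 0 := cl_mul_ne J (Ne.symm hm) x (.nil 1)
          rw [h0, mul_zero]
          cases x with
          | nil a => exact (hm rfl).elim
          | cons x β b => rw [π_cons, map_zero]
      · have h0 : ι J j 1 * cl J x = 0 := cl_mul_ne J hl (.nil 1) x
        rw [← mul_assoc, h0, zero_mul]
        cases x with
        | nil a => rw [π_nil, Pi.single_eq_of_ne (Ne.symm hl), map_zero]
        | cons x β b => rw [π_cons, map_zero]
  · rw [φ_one, φ_one]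
    change op (ι J l 1 * (r.unop * ι J j 1)) = op 0
    congr 1
    generalize r.unop = v
    induction v using cl_induction with
    | zero => simp
    | add v w hv hw => simp only [add_mul, mul_add, hv, hw, add_zero]
    | cl p m x =>
      by_cases hp : p = l
      · subst hp
        by_cases hm : m = j
        · subst hm
          cases x with
          | nil a => exact (hl rfl).elim
          | cons x β b => exact (hlt ⟨(x.cons β b).path, by simp [APath.path]⟩).elim
        · have h0 : cl J x * ι J j 1 = 0 := cl_mul_ne J (Ne.symm hm) x (.nil 1)
          rw [h0, mul_zero]
      · have h0 : ι J l 1 * cl J x = 0 := cl_mul_ne J hp (.nil 1) x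
        rw [← mul_assoc, h0, zero_mul]

theorem arrowCorner_subsingleton (i : V) (hj : ¬ IsSucc V j i) :
    Subsingleton (Corner (φ J j) (arrowModule J i)) := by
  refine subsingleton_of_forall_eq 0 fun n => Subtype.ext (Subtype.ext ?_)
  have h : ∀ v ∈ arrowModule J i, v * ι J j 1 = 0 := by
    intro v hv
    induction hv using mem_arrowModule_induction with
    | zero => rw [zero_mul]
    | add v w _ _ hv hw => rw [add_mul, hv, hw, add_zero]
    | mul m γ v =>
      induction v using cl_induction with
      | zero => simp
      | add v w hv hw => rw [mul_add, add_mul, hv, hw, add_zero]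
      | cl p q w =>
        by_cases hp : p = m
        · subst hp
          by_cases hq : q = j
          · subst hq
            exact (hj ⟨(Quiver.Hom.toPath γ).comp w.path, by
              rw [Quiver.Path.length_comp]; simp⟩).elim
          · have h0 : cl J w * ι J j 1 = 0 := cl_mul_ne J (Ne.symm hq) w (.nil 1)
            rw [mul_assoc, h0, mul_zero]
        · have h0 : ar J γ * cl J w = 0 := cl_mul_ne J hp _ w
          rw [h0, zero_mul]
  have h1 := congrArg Subtype.val ((Corner.mem_iff (φ J j)).1 n.2)
  exact h1.symm.trans (h _ n.1.2)

end GPQ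

end

end

/-! ### The projective dimension of `N_i` -/

section

open TensorProduct MulOpposite

noncomputable section

namespace GPQ

variable {k : Type u} [Field k] {V : Type u} [Quiver.{u} V] {A : V → Type u}
  [∀ i, Ring (A i)] [∀ i, Algebra k (A i)] [Fintype V]
  {I : ∀ i j : V, Set (Quiver.Path i j →₀ k)} {J : TwoSidedIdeal (GPA k A)}

theorem arrowModule_subsingleton {i : V} (h : ∀ m : V, IsEmpty (i ⟶ m)) :
    Subsingleton (arrowModule J i) := by
  refine subsingleton_of_forall_eq 0 fun n => Subtype.ext ?_
  have h : ∀ v ∈ arrowModule J i, v = 0 := by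
    intro v hv
    induction hv using mem_arrowModule_induction with
    | zero => rfl
    | add v w _ _ hv hw => rw [hv, hw, add_zero]
    | mul m γ v => exact ((h m).false γ).elim
  exact h _ n.2

theorem left_mul_of_mem {T : Type u} [AddCommGroup T] [Module k T] [Module (GPQ J)ᵐᵒᵖ T]
    [IsScalarTower k (GPQ J)ᵐᵒᵖ T] {θ : ∀ i l : V, (i ⟶ l) → A i →ₗ[k] T}
    (hJ : GPA.GeneratedBy I J) (hθ : Respects (J := J) θ I) {i : V} {n : GPQ J}
    (hn : n ∈ arrowModule J i) (v : GPQ J) :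
    left hJ hθ (n * v) = op v • left hJ hθ n := by
  induction hn using mem_arrowModule_induction with
  | zero => rw [zero_mul, map_zero, smul_zero]
  | add w w' _ _ hw hw' => rw [add_mul, map_add, hw, hw', map_add, smul_add]
  | mul m γ w =>
    rw [mul_assoc, ar, left_cons_mul, left_cons_mul, smul_smul, ← op_mul]

variable (J) in
open Classical in
/-- The map `a γ ↦ f(a) γ` for arrows `γ` starting at `i`, with values in a free module on the
arrows. -/
def freeθ (i : V) (f : A i →ₗ[k] k) (l m : V) (γ : l ⟶ m) :
    A l →ₗ[k] ((Σ l m : V, l ⟶ m) →₀ (GPQ J)ᵐᵒᵖ) :=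
  (LinearMap.toSpanSingleton k _ (Finsupp.single ⟨l, m, γ⟩ (op (ι J m 1)))) ∘ₗ
    f ∘ₗ LinearMap.proj i ∘ₗ LinearMap.single k A l

open Classical in
theorem freeθ_apply (i : V) (f : A i →ₗ[k] k) {l m : V} (γ : l ⟶ m) (a : A l) :
    freeθ J i f l m γ a = f ((Pi.single l a : ∀ l, A l) i) •
      Finsupp.single (⟨l, m, γ⟩ : Σ l m : V, l ⟶ m) (op (ι J m 1)) := rfl

theorem freeθ_respects {i : V} (hI : ∀ j, ∀ ρ ∈ I i j, ρ = 0) (f : A i →ₗ[k] k) :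
    Respects (J := J) (freeθ J i f) I := by
  classical
  intro l j ρ hρ x hx _ a
  by_cases h : i = l
  · subst h
    rw [hI j ρ hρ, Finsupp.sum_zero_index]
  · refine Finset.sum_eq_zero fun p hp => ?_
    obtain ⟨m, γ, w, hw⟩ := hx p hp
    change ρ p • _ = _
    rw [hw, APath.nil_mul_cons_mul, leftD_mul, freeθ_apply, Pi.single_eq_of_ne h, map_zero,
      zero_smul, smul_zero, smul_zero]

/-- When no relation starts at `i`, nothing obstructs sending `γ v` to the basis vector of `γ` times
`v`; this splits the map from a free module on the arrows onto `N_i`. -/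
theorem arrowModule_projective (hJ : GPA.GeneratedBy I J) {i : V}
    (hI : ∀ j, ∀ ρ ∈ I i j, ρ = 0) : Module.Projective (GPQ J)ᵐᵒᵖ (arrowModule J i) := by
  classical
  -- If `A i = 0` then `e_i = 0` and `N_i = 0`. Otherwise there is a functional `f` with `f 1 = 1`,
  -- which turns the entry before the first arrow into a scalar.
  rcases subsingleton_or_nontrivial (A i) with hA | hA
  · have : Subsingleton (arrowModule J i) := by
      refine subsingleton_of_forall_eq 0 fun n => Subtype.ext ?_
      rw [← ι_one_mul_of_mem n.2, Subsingleton.elim (1 : A i) 0, map_zero, zero_mul]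
      rfl
    infer_instance
  obtain ⟨f, hf⟩ := LinearMap.exists_leftInverse_of_injective
    (LinearMap.toSpanSingleton k (A i) 1)
    (LinearMap.ker_toSpanSingleton k (one_ne_zero : (1 : A i) ≠ 0))
  have hf1 : f 1 = 1 := by simpa using LinearMap.congr_fun hf 1
  let G := left hJ (freeθ_respects (J := J) hI f)
  let s : arrowModule J i →ₗ[(GPQ J)ᵐᵒᵖ] ((Σ l m : V, l ⟶ m) →₀ (GPQ J)ᵐᵒᵖ) :=
    { toFun := fun n => G n
      map_add' := fun v w => map_add G _ _
      map_smul' := fun v n => left_mul_of_mem hJ _ n.2 v.unop }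
  let h : ((Σ l m : V, l ⟶ m) →₀ (GPQ J)ᵐᵒᵖ) →ₗ[(GPQ J)ᵐᵒᵖ] arrowModule J i :=
    Finsupp.lsum ℕ fun γ => LinearMap.toSpanSingleton _ _
      ⟨ι J i 1 * ar J γ.2.2, ι_mul_ar_mem i γ.2.2⟩
  refine Module.Projective.of_split s h (LinearMap.ext fun n => ?_)
  refine Subtype.ext ?_
  have key : ∀ v ∈ arrowModule J i, ((h (G v) : arrowModule J i) : GPQ J) = v := by
    intro v hv
    induction hv using mem_arrowModule_induction with
    | zero => rw [map_zero, map_zero]; rfl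
    | add v w _ _ hv hw => rw [map_add, map_add, Submodule.coe_add, hv, hw]
    | mul m γ v =>
      have h1 : G (ar J γ) = Finsupp.single (⟨i, m, γ⟩ : Σ l m : V, l ⟶ m) (op (ι J m 1)) := by
        have h2 := left_mul hJ (freeθ_respects (J := J) hI f) γ (1 : A i) (APath.nil (1 : A m))
        rw [APath.mul_one', freeθ_apply, Pi.single_eq_same, hf1, one_smul, Finsupp.smul_single,
          smul_eq_mul, ← op_mul] at h2
        refine h2.trans ?_
        congr 2
        exact mul_ι_one J (.nil 1)
      change ((h (left hJ _ (ar J γ * v)) : arrowModule J i) : GPQ J) = _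
      rw [left_mul_of_mem hJ _ (ar_mem γ), map_smul]
      change ((h (G (ar J γ)) : arrowModule J i) : GPQ J) * v = _
      rw [h1, Finsupp.lsum_single]
      change ι J i 1 * ar J γ * ι J m 1 * v = _
      rw [ι_mul_ar]
      congr 1
      exact mul_ι_one J _
  exact key n n.2

/-- The projective dimensions of the modules supported at a vertex, in terms of the module
generated by the arrows starting at it. -/
theorem pdLT_infl (hJ : GPA.GeneratedBy I J) (i : V) [Module.Finite k (A i)] {n : ℕ}
    (X : Type u) [AddCommGroup X] [Module (A i)ᵐᵒᵖ X] [Module.Finite (A i)ᵐᵒᵖ X]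
    (hX : PdLT (A i)ᵐᵒᵖ X (n + 1)) (hN : PdLT (GPQ J)ᵐᵒᵖ (arrowModule J i) n) :
    PdLT (GPQ J)ᵐᵒᵖ (Infl (coneData hJ i).π.toRingHom X) (n + 1) := by
  have : Module.Finite k (A i)ᵐᵒᵖ := Module.Finite.equiv (opLinearEquiv k)
  exact (coneData hJ i).pdLT_infl X hX hN

/-- Here `S i n` stands for `pd S_i < n` over `kΓ/I`: `hS0` says that `S_i` is nonzero, `hS1` that
it is not projective when an arrow starts at `i`, and `hS` is the condition on the starts of
relations. -/
theorem pdLT_arrowModule (hJ : GPA.GeneratedBy I J)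
    (hV : ∀ (i : V) (p : Quiver.Path i i), p.length = 0) [∀ i, Module.Finite k (A i)]
    [Module.Finite k (GPQ J)] (S : V → ℕ → Prop)
    (hS0 : ∀ i, ¬ S i 0) (hS1 : ∀ i m, (i ⟶ m) → ¬ S i 1)
    (hS : ∀ i, (∃ l, ∃ ρ ∈ I i l, ρ ≠ 0) → ∀ j, IsSucc V j i → ∀ n, S i (n + 1) → S j n)
    (i : V) (n : ℕ) (h : S i (n + 1)) : PdLT (GPQ J)ᵐᵒᵖ (arrowModule J i) n := by
  induction i using (isSucc_wellFounded hV).1.induction generalizing n with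
  | _ i ih =>
  by_cases hrel : ∃ l, ∃ ρ ∈ I i l, ρ ≠ 0
  · refine pdLT_of_corners hJ hV _ fun j => ?_
    by_cases hj : IsSucc V j i
    · have hSj := hS i hrel j hj n h
      match n with
      | 0 => exact (hS0 j hSj).elim
      | n + 1 =>
        have := arrowCorner_finite j hJ i
        have := arrowCorner_projective j hJ i
        -- The corner `N_i e_j` is projective over `A j`, so only the bound for `N_j`, known by
        -- induction, limits its inflation.
        exact pdLT_infl hJ j _ PdLT.of_projective (ih j hj n hSj)
    · have := arrowCorner_subsingleton (J := J) j i hj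
      exact PdLT.of_subsingleton
  · push Not at hrel
    match n with
    | 0 =>
      -- The assumption is now `pd S_i < 1`, so `S_i` is projective and no arrow starts at `i`.
      have := arrowModule_subsingleton (J := J) (i := i) fun m => ⟨fun γ => hS1 i m γ h⟩
      exact PdLT.of_subsingleton
    | n + 1 =>
      have := arrowModule_projective hJ hrel
      exact PdLT.of_projective

end GPQ

end

end

/-! ### Finite-dimensionality -/

section

open TensorProduct MulOpposite

noncomputable section

section Finiteness

variable {k : Type u} [Field k] {V : Type u} [Quiver.{u} V] {A : V → Type u}
  [∀ i, Ring (A i)] [∀ i, Algebra k (A i)]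

namespace APath

/-- The product of the entries of an `𝒜`-path over the ground field. -/
def prod {i : V} : ∀ {j : V}, APath (fun _ : V => k) i j → k
  | _, .nil a => a
  | _, .cons x _ b => prod x * b

theorem path_rmul {i j : V} (x : APath A i j) (b : A j) : (x.rmul b).path = x.path := by
  cases x <;> rfl

theorem path_mul {i j l : V} (x : APath A i j) (y : APath A j l) :
    (x.mul y).path = x.path.comp y.path := by
  induction y with
  | nil b => exact path_rmul x b
  | cons y β b ih => exact congrArg (fun p => Quiver.Path.cons p β) ih

theorem path_ofPath {i j : V} (p : Quiver.Path i j) : (ofPath A p).path = p := by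
  induction p with
  | nil => rfl
  | cons p β ih => exact congrArg (fun p => Quiver.Path.cons p β) ih

theorem prod_ofPath {i j : V} (p : Quiver.Path i j) : (ofPath (fun _ : V => k) p).prod = 1 := by
  induction p with
  | nil => rfl
  | cons p β ih => rw [ofPath, prod, ih, one_mul]

end APath

namespace GPA

theorem of_cons {i j l : V} (x : APath A i j) (β : j ⟶ l) (b : A l) : of k A (x.cons β b) =
    of k A x * of k A ((APath.nil 1).cons β 1) * of k A (.nil b) := by
  rw [of_mul_of, of_mul_of]
  change _ = of k A ((x.rmul 1).cons β (1 * b))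
  rw [APath.rmul_one, one_mul]

variable [Fintype V]

variable (k A) in
/-- The inclusion of the algebra at a vertex. -/
def nilL (i : V) : A i →ₗ[k] GPA k A where
  toFun a := of k A (.nil a)
  map_add' a b := of_add k (APath.IsAdd.nil a b)
  map_smul' _ a := of_smul k (APath.IsSMul.nil a)

variable (k A) in
/-- The subspace spanned by the `𝒜`-paths of a given length. -/
def ofLength : ℕ → Submodule k (GPA k A)
  | 0 => ⨆ i, LinearMap.range (nilL k A i)
  | n + 1 => ofLength n * Submodule.span k (Set.range fun β : Σ i j : V, i ⟶ j =>
      of k A ((APath.nil 1).cons β.2.2 1)) * ⨆ i, LinearMap.range (nilL k A i)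

theorem of_mem_ofLength {i j : V} (x : APath A i j) :
    of k A x ∈ ofLength k A x.path.length := by
  induction x with
  | nil a => exact Submodule.mem_iSup_of_mem _ ⟨a, rfl⟩
  | @cons j l x β b ih =>
    rw [of_cons]
    exact Submodule.mul_mem_mul (Submodule.mul_mem_mul ih (Submodule.subset_span ⟨⟨j, l, β⟩, rfl⟩))
      (Submodule.mem_iSup_of_mem _ ⟨b, rfl⟩)

theorem ofLength_fg [∀ i j : V, Finite (i ⟶ j)] [∀ i, Module.Finite k (A i)] (n : ℕ) :
    (ofLength k A n).FG := by
  have h0 : (⨆ i, LinearMap.range (nilL k A i)).FG :=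
    Submodule.fg_iSup _ fun i => (Submodule.fg_top _).1 Module.Finite.fg_top
  induction n with
  | zero => exact h0
  | succ n ih => exact (ih.mul (Submodule.fg_span (Set.finite_range _))).mul h0

theorem iSup_ofLength_fg [∀ i j : V, Finite (i ⟶ j)] [∀ i, Module.Finite k (A i)] (m : ℕ) :
    (⨆ n : Fin m, ofLength k A n).FG :=
  Submodule.fg_iSup _ fun n => ofLength_fg n

theorem range_le_of_length {W : Type*} [AddCommGroup W] [Module k W] (f : GPA k A →ₗ[k] W) (m : ℕ)
    (h : ∀ (i j : V) (x : APath A i j), m ≤ x.path.length → f (of k A x) = 0) :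
    LinearMap.range f ≤ (⨆ n : Fin m, ofLength k A n).map f := by
  have : ((⨆ n : Fin m, ofLength k A n).map f).mkQ ∘ₗ f = 0 := by
    refine hom_ext k fun i j x => ?_
    refine (Submodule.Quotient.mk_eq_zero _).2 ?_
    by_cases hx : x.path.length < m
    · exact Submodule.mem_map_of_mem
        (Submodule.mem_iSup_of_mem (⟨_, hx⟩ : Fin m) (of_mem_ofLength x))
    · rw [h i j x (not_lt.1 hx)]
      exact zero_mem _
  rintro _ ⟨v, rfl⟩
  exact (Submodule.Quotient.mk_eq_zero _).1 (LinearMap.congr_fun this v)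

theorem finite_of_surjective [∀ i j : V, Finite (i ⟶ j)] [∀ i, Module.Finite k (A i)]
    {W : Type*} [AddCommGroup W] [Module k W] (f : GPA k A →ₗ[k] W)
    (hf : Function.Surjective f) (m : ℕ)
    (h : ∀ (i j : V) (x : APath A i j), m ≤ x.path.length → f (of k A x) = 0) :
    Module.Finite k W := by
  have h1 := range_le_of_length f m h
  rw [LinearMap.range_eq_top.2 hf] at h1
  exact ⟨top_le_iff.1 h1 ▸ (iSup_ofLength_fg m).map f⟩

end GPA

/-- Each arrow strictly enlarges the set of predecessors of the end vertex: its source becomes a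
predecessor, and by acyclicity was not one of itself. -/
theorem Quiver.Path.length_le_ncard_isSucc [Finite V]
    (hV : ∀ (i : V) (p : Quiver.Path i i), p.length = 0) {i j : V} (p : Quiver.Path i j) :
    p.length ≤ {l | GPQ.IsSucc V j l}.ncard := by
  induction p with
  | nil => exact Nat.zero_le _
  | @cons j l p β ih =>
    refine ih.trans_lt (Set.ncard_lt_ncard ⟨?_, fun h => ?_⟩ (Set.toFinite _))
    · rintro m ⟨q, hq⟩
      exact ⟨q.cons β, Nat.succ_pos _⟩
    · obtain ⟨q, hq⟩ := h (show GPQ.IsSucc V l j from ⟨β.toPath, Nat.one_pos⟩)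
      exact hq.ne' (hV j q)

theorem GPA.finite_of_acyclic [Fintype V] [∀ i j : V, Finite (i ⟶ j)]
    [∀ i, Module.Finite k (A i)] (hV : ∀ (i : V) (p : Quiver.Path i i), p.length = 0) :
    Module.Finite k (GPA k A) := by
  refine GPA.finite_of_surjective LinearMap.id Function.surjective_id (Nat.card V + 1)
    fun i j x hx => ?_
  have h := (x.path.length_le_ncard_isSucc hV).trans (Set.ncard_le_card _)
  omega

variable [Fintype V]

theorem GPA.of_eq_smul_ofPath {i j : V} (x : APath (fun _ : V => k) i j) :
    GPA.of k _ x = x.prod • PathAlgebra.ofPath k x.path := by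
  have hnil : ∀ {j : V} (a : k), GPA.of k (fun _ : V => k) (.nil a : APath _ j j) =
      a • GPA.of k (fun _ : V => k) (.nil 1) := fun {j} a => by
    have := APath.IsSMul.nil (k := k) (A := fun _ : V => k) (i := j) (t := a) 1
    rw [smul_eq_mul, mul_one] at this
    exact GPA.of_smul k this
  induction x with
  | nil a => exact hnil a
  | @cons j l x β b ih =>
    have h := GPA.of_cons (k := k) (APath.ofPath (fun _ : V => k) x.path) β 1
    rw [GPA.of_cons, ih, hnil b, smul_mul_assoc, smul_mul_assoc, mul_smul_comm, smul_smul]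
    exact congrArg (_ • ·) h.symm

/-- The ideal is generated by paths of length exactly `m`, so a longer path is cut down from the
right until that length is reached. -/
theorem GPA.of_mem_arrowIdealPow {m : ℕ} {i j : V} (x : APath (fun _ : V => k) i j)
    (h : m ≤ x.path.length) : GPA.of k _ x ∈ arrowIdealPow k V m := by
  have heq : ∀ {j : V} (x : APath (fun _ : V => k) i j), x.path.length = m →
      GPA.of k _ x ∈ arrowIdealPow k V m := fun x hx => by
    rw [GPA.of_eq_smul_ofPath, Algebra.smul_def]
    exact TwoSidedIdeal.mul_mem_left _ _ _ (TwoSidedIdeal.subset_span ⟨_, _, _, hx, rfl⟩)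
  induction x with
  | nil a => exact heq _ (Nat.le_zero.1 h).symm
  | cons x β b ih =>
    obtain h | h := h.eq_or_lt
    · exact heq _ h.symm
    · rw [GPA.of_cons]
      exact TwoSidedIdeal.mul_mem_right _ _ _
        (TwoSidedIdeal.mul_mem_right _ _ _ (ih (Nat.lt_succ_iff.1 h)))

/-- An admissible ideal contains all paths of length at least some `m`, and the shorter paths span a
finite-dimensional space. -/
theorem BoundQuiverPresentation.finite {A : Type u} [Ring A] [Algebra k A]
    (P : BoundQuiverPresentation k A) : Module.Finite k A := by
  obtain ⟨⟨m, -, hm⟩, -⟩ := P.admissible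
  exact GPA.finite_of_surjective P.toAlgebra.toLinearMap P.surjective m fun i j x hx =>
    (TwoSidedIdeal.mem_ker P.toAlgebra).1 (hm (GPA.of_mem_arrowIdealPow x hx))

end Finiteness

end

end

/-! ### Coefficients of paths, the generators of both ideals, and the vertex simples -/

section

open TensorProduct MulOpposite

noncomputable section

section PathCoefficients

variable {k : Type u} [Field k] {V : Type u} [Quiver.{u} V]

theorem APath.IsAdd.path_eq {A : V → Type u} [∀ i, Ring (A i)] {i j : V} {x y z : APath A i j}
    (h : IsAdd x y z) : y.path = x.path ∧ z.path = x.path := by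
  induction h with
  | nil => exact ⟨rfl, rfl⟩
  | last => exact ⟨rfl, rfl⟩
  | cons h β c ih => simp only [path, ih, and_self]

theorem APath.IsSMul.path_eq {A : V → Type u} [∀ i, Ring (A i)] [∀ i, Algebra k (A i)] {t : k}
    {i j : V} {x y : APath A i j} (h : IsSMul t x y) : y.path = x.path := by
  induction h with
  | nil => rfl
  | last => rfl
  | cons h β c ih => simp only [path, ih]

namespace PathAlgebra

variable (k V) in
/-- The coefficients of the paths in an element of the path algebra. -/
def coeff : PathAlgebra k V →ₗ[k] (Σ i j : V, Quiver.Path i j) →₀ k :=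
  GPA.lift k (fun i j x => Finsupp.single ⟨i, j, x.path⟩ x.prod)
    (fun i j x y z h => by
      have h2 : x.prod = y.prod + z.prod := by
        induction h with
        | nil => rfl
        | last => exact mul_add _ _ _
        | cons h β c ih => simp only [APath.prod, ih, add_mul]
      rw [h.path_eq.1, h.path_eq.2, h2, Finsupp.single_add])
    (fun i j t x y h => by
      have h2 : x.prod = t * y.prod := by
        induction h with
        | nil => rfl
        | last => exact mul_left_comm _ _ _
        | cons h β c ih => simp only [APath.prod, ih, mul_assoc]
      rw [h.path_eq, h2, Finsupp.smul_single, smul_eq_mul])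

theorem coeff_of {i j : V} (x : APath (fun _ : V => k) i j) :
    coeff k V (GPA.of k _ x) = Finsupp.single ⟨i, j, x.path⟩ x.prod := GPA.lift_of _ _ _ _ _

theorem coeff_ofPath {i j : V} (p : Quiver.Path i j) :
    coeff k V (ofPath k p) = Finsupp.single ⟨i, j, p⟩ 1 := by
  rw [ofPath, coeff_of, APath.path_ofPath, APath.prod_ofPath]

variable [Fintype V]

theorem coeff_eq_zero {n : ℕ} {i j : V} (p : Quiver.Path i j) (hp : p.length < n) :
    ∀ v ∈ arrowIdealPow k V n, coeff k V v ⟨i, j, p⟩ = 0 := by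
  intro v hv
  refine GPA.map_span_eq_zero (Finsupp.lapply ⟨i, j, p⟩ ∘ₗ coeff k V) ?_ hv
  rintro _ ⟨a, b, q, hq, rfl⟩ i' j' x l m y
  rw [ofPath]
  by_cases h1 : a = j'
  · by_cases h2 : l = b
    · subst h1 h2
      rw [GPA.of_mul_of, GPA.of_mul_of, LinearMap.comp_apply, coeff_of]
      refine Finsupp.single_eq_of_ne fun h => ?_
      have h3 := congrArg (fun z : Σ i j : V, Quiver.Path i j => z.2.2.length) h
      simp only [APath.path_mul, APath.path_ofPath, Quiver.Path.length_comp] at h3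
      omega
    · rw [mul_assoc, GPA.of_mul_of_ne k h2, mul_zero, map_zero]
  · rw [GPA.of_mul_of_ne k h1, zero_mul, map_zero]

theorem coeff_sum {i j : V} (ρ : Quiver.Path i j →₀ k) (p : Quiver.Path i j) :
    coeff k V (ρ.sum fun p t => t • ofPath k p) ⟨i, j, p⟩ = ρ p := by
  classical
  simp only [Finsupp.sum, map_sum, map_smul, coeff_ofPath, Finsupp.finsetSum_apply]
  rw [Finset.sum_eq_single p]
  · simp
  · intro q _ hq
    rw [Finsupp.smul_apply, Finsupp.single_eq_of_ne (by simpa using hq.symm), smul_zero]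
  · intro h
    simp [Finsupp.notMem_support_iff.1 h]

/-- The paths that occur in a relation have length at least two. -/
theorem two_le_length {I : ∀ i j : V, Set (Quiver.Path i j →₀ k)}
    (hI : relationIdeal k I ≤ arrowIdealPow k V 2) {i j : V} {ρ : Quiver.Path i j →₀ k}
    (hρ : ρ ∈ I i j) {p : Quiver.Path i j} (hp : p ∈ ρ.support) : 2 ≤ p.length := by
  by_contra! h
  refine Finsupp.mem_support_iff.1 hp ?_
  rw [← coeff_sum ρ p]
  exact coeff_eq_zero p h _ (hI (TwoSidedIdeal.subset_span ⟨i, j, ρ, hρ, rfl⟩))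

end PathAlgebra

end PathCoefficients

section Inserts

variable {k : Type u} [Field k] {V : Type u} [Quiver.{u} V] {A : V → Type u}
  [∀ i, Ring (A i)] [∀ i, Algebra k (A i)]

theorem APath.HeadOne.cons_cons {i j l m : V} {x : APath A i j} {β : j ⟶ l}
    (h : (x.cons β 1).HeadOne) (a : A l) (β' : l ⟶ m) (b : A m) :
    ((x.cons β a).cons β' b).HeadOne := by
  obtain ⟨m', γ, w, hw⟩ := h
  refine ⟨m', γ, (w.mul (.nil a)).cons β' b, ?_⟩
  change _ = (((APath.nil 1).cons γ 1).mul (w.mul (.nil a))).cons β' b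
  rw [← APath.mul_assoc', ← hw]
  simp [APath.mul, APath.rmul]

theorem Inserts.headOne_tailOne {P : ∀ i, BoundQuiverPresentation k (A i)} {i j : V}
    {p : Quiver.Path i j} {x : APath A i j} (h : Inserts P p x) (hp : 0 < p.length) :
    x.HeadOne ∧ x.TailOne := by
  induction h with
  | nil => exact hp.false.elim
  | arrow β => exact ⟨⟨_, β, .nil 1, by simp [APath.mul, APath.rmul]⟩, ⟨_, _, β, rfl⟩⟩
  | step h γ β' ih =>
    exact ⟨(ih (Nat.succ_pos _)).1.cons_cons _ β' 1, ⟨_, _, β', rfl⟩⟩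

theorem APath.ofPath_headOne_tailOne {i j : V} {p : Quiver.Path i j} (hp : 0 < p.length) :
    (ofPath A p).HeadOne ∧ (ofPath A p).TailOne := by
  induction p with
  | nil => exact hp.false.elim
  | cons p β ih =>
    refine ⟨?_, ⟨_, _, β, rfl⟩⟩
    cases p with
    | nil => exact ⟨_, β, .nil 1, by simp [ofPath, APath.mul, APath.rmul]⟩
    | cons p γ => exact (ih (Nat.succ_pos _)).1.cons_cons 1 β 1

variable [Fintype V] {I : ∀ i j : V, Set (Quiver.Path i j →₀ k)}

/-- Admissibility forces the paths in a relation to have length at least two; insertion only touches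
inner vertices, so both end entries stay `1`. -/
theorem gbpIdeal_generatedBy (P : ∀ i, BoundQuiverPresentation k (A i))
    (hI : relationIdeal k I ≤ arrowIdealPow k V 2) : GPA.GeneratedBy I (gbpIdeal P I) := by
  refine ⟨_, rfl, ?_⟩
  rintro _ ⟨i, j, ρ, hρ, x, hx, rfl⟩
  exact ⟨i, j, ρ, hρ, x, fun p hp => (hx p hp).headOne_tailOne
    (Nat.zero_lt_of_lt (PathAlgebra.two_le_length hI hρ hp)), rfl⟩

theorem relationIdeal_generatedBy (hI : relationIdeal k I ≤ arrowIdealPow k V 2) :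
    GPA.GeneratedBy I (relationIdeal k I) := by
  refine ⟨_, rfl, ?_⟩
  rintro _ ⟨i, j, ρ, hρ, rfl⟩
  exact ⟨i, j, ρ, hρ, APath.ofPath _, fun p hp => APath.ofPath_headOne_tailOne
    (Nat.zero_lt_of_lt (PathAlgebra.two_le_length hI hρ hp)), rfl⟩

end Inserts

section VertexSimple

variable {k : Type u} [Field k] {V : Type u} [Quiver.{u} V] [Fintype V]
  {I : ∀ i j : V, Set (Quiver.Path i j →₀ k)}

open GPQ

/-- The augmentation of the bound path algebra at a vertex vanishes on the right ideal which
defines the simple module over this vertex. -/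
theorem π_eq_zero_of_mem (hJ : GPA.GeneratedBy I (relationIdeal k I)) (j : V)
    {v : BoundPathAlgebra k I} (hv : v ∈ Submodule.span (BoundPathAlgebra k I)ᵐᵒᵖ
    ({x | ∃ (i l : V) (β : i ⟶ l), x = BoundPathAlgebra.ofPath I β.toPath} ∪
     {x | ∃ i : V, i ≠ j ∧ x = BoundPathAlgebra.ofPath I (Quiver.Path.nil : Quiver.Path i i)})) :
    π hJ j v = 0 := by
  classical
  induction hv using Submodule.span_induction with
  | mem v hv =>
    obtain ⟨i, l, β, rfl⟩ | ⟨i, hi, rfl⟩ := hv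
    · exact π_cons hJ j (APath.nil (1 : k)) β 1
    · refine (π_nil hJ j (i := i) (1 : k)).trans ?_
      exact Pi.single_eq_of_ne hi.symm _
  | zero => exact map_zero (π hJ j)
  | add v w _ _ hv hw =>
    exact (map_add (π hJ j) v w).trans ((congrArg₂ (· + ·) hv hw).trans (add_zero 0))
  | smul b v _ hv =>
    exact (map_mul (π hJ j) v b.unop).trans ((congrArg (· * _) hv).trans (zero_mul _))

theorem vertexSimple_not_subsingleton (hJ : GPA.GeneratedBy I (relationIdeal k I)) (j : V) :
    ¬ Subsingleton (VertexSimple I j) := by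
  intro h
  have h1 := (Submodule.Quotient.mk_eq_zero _).1 (Subsingleton.elim
    (Submodule.Quotient.mk (1 : BoundPathAlgebra k I) : VertexSimple I j) 0)
  exact one_ne_zero ((map_one (π hJ j)).symm.trans (π_eq_zero_of_mem hJ j h1))

/-- A section of `kΓ/I → S_j` would yield an element `v` with `π_j v = 1` and `v β = 0`. The
coefficient of the arrow `β` is well defined on `kΓ/I`, because `(I)` lies in the square of the
arrow ideal, and in `v β` it equals `π_j v = 1`. -/
theorem vertexSimple_not_projective (hI : relationIdeal k I ≤ arrowIdealPow k V 2) {j l : V}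
    (β : j ⟶ l) : ¬ Module.Projective (BoundPathAlgebra k I)ᵐᵒᵖ (VertexSimple I j) := by
  intro h
  have hJ := relationIdeal_generatedBy hI
  obtain ⟨s, hs⟩ := Module.projective_lifting_property (Submodule.mkQ (Submodule.span
    (BoundPathAlgebra k I)ᵐᵒᵖ
    ({x | ∃ (i l : V) (β : i ⟶ l), x = BoundPathAlgebra.ofPath I β.toPath} ∪
     {x | ∃ i : V, i ≠ j ∧ x = BoundPathAlgebra.ofPath I (Quiver.Path.nil : Quiver.Path i i)})))
     LinearMap.id (Submodule.mkQ_surjective _)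
  let o : VertexSimple I j := Submodule.Quotient.mk (1 : BoundPathAlgebra k I)
  let a : BoundPathAlgebra k I := BoundPathAlgebra.ofPath I β.toPath
  have h1 : op a • o = 0 := by
    refine (Submodule.Quotient.mk_eq_zero _).2 ?_
    refine Submodule.subset_span (Or.inl ⟨j, l, β, ?_⟩)
    exact one_mul a
  have h2 : s o * a = 0 := by
    have := map_smul s (op a) o
    rw [h1, map_zero] at this
    exact this.symm
  have h3 : π hJ j (s o) = 1 := by
    have h4 := (Submodule.Quotient.eq _).1 (LinearMap.congr_fun hs o)
    have h5 := π_eq_zero_of_mem hJ j h4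
    exact (sub_eq_zero.1 ((map_sub (π hJ j) (s o) 1).symm.trans h5)).trans (map_one (π hJ j))
  let c : GPQ (relationIdeal k I) →ₗ[k] k :=
    GPQ.lift (Finsupp.lapply (⟨j, l, β.toPath⟩ : Σ i j : V, Quiver.Path i j) ∘ₗ
      PathAlgebra.coeff k V) fun v hv => PathAlgebra.coeff_eq_zero β.toPath one_lt_two v (hI hv)
  have h6 : c ∘ₗ LinearMap.mulRight k (ar (relationIdeal k I) β) = (π hJ j).toLinearMap := by
    classical
    refine GPQ.hom_ext fun a b x => ?_
    change c (cl _ x * ar _ β) = π hJ j (cl _ x)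
    by_cases hb : j = b
    · subst hb
      rw [ar, ← cl_mul]
      refine (congrArg (fun f => f (⟨j, l, β.toPath⟩ : Σ i j : V, Quiver.Path i j))
        (PathAlgebra.coeff_of (x.mul ((APath.nil 1).cons β 1)))).trans ?_
      cases x with
      | nil t =>
        rw [π_nil, Pi.single_eq_same]
        refine Finsupp.single_eq_same.trans ?_
        exact (mul_one _).trans (mul_one t)
      | cons x γ t =>
        rw [π_cons]
        refine Finsupp.single_eq_of_ne fun h => ?_
        have h3 := congrArg (fun z : Σ i j : V, Quiver.Path i j => z.2.2.length) h
        simp [APath.path_mul, APath.path] at h3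
    · rw [ar, cl_mul_ne _ hb, map_zero]
      cases x with
      | nil t => rw [π_nil, Pi.single_eq_of_ne hb]
      | cons => rw [π_cons]
  have h7 := LinearMap.congr_fun h6 (s o)
  have h8 : (show GPQ (relationIdeal k I) from s o) * ar (relationIdeal k I) β = 0 := h2
  refine one_ne_zero (α := k) (h3.symm.trans (h7.symm.trans ?_))
  exact (congrArg c h8).trans (map_zero c)

theorem vertexSimple_finite (j : V) :
    Module.Finite (BoundPathAlgebra k I)ᵐᵒᵖ (VertexSimple I j) := by
  have : Module.Finite (BoundPathAlgebra k I)ᵐᵒᵖ (BoundPathAlgebra k I) :=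
    Module.Finite.equiv (MulOpposite.opLinearEquiv (BoundPathAlgebra k I)ᵐᵒᵖ).symm
  infer_instance

end VertexSimple

end

end

/-! ### Global dimensions and the two inequalities -/

section

open CategoryTheory TensorProduct

noncomputable section

section GlobalDimension

variable {R : Type u} [Ring R] {M : Type u} [AddCommGroup M] [Module Rᵐᵒᵖ M] {n : ℕ}

theorem rightProjDim_lt_iff : rightProjDim R M < n ↔ PdLT Rᵐᵒᵖ M n := projectiveDimension_lt_iff

theorem pdLT_of_globalDim_lt (h : globalDim R < n) [hM : Module.Finite Rᵐᵒᵖ M] : PdLT Rᵐᵒᵖ M n :=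
  rightProjDim_lt_iff.1 (lt_of_le_of_lt
    (le_iSup₂ (f := fun (M : ModuleCat.{u} Rᵐᵒᵖ) (_ : Module.Finite Rᵐᵒᵖ M) =>
      projectiveDimension M) (ModuleCat.of Rᵐᵒᵖ M) hM) h)

/-- Strict natural upper bounds determine an element of `WithBot ℕ∞`: `n = 0` detects `⊥`, and `n =
m + 1` detects the value `m`. -/
theorem WithBot.le_of_forall_natCast_lt {a c : WithBot ℕ∞} (h : ∀ n : ℕ, c < n → a < n) :
    a ≤ c := by
  induction c with
  | bot => exact ((WithBot.lt_zero_iff_eq_bot _).1 (h 0 (WithBot.bot_lt_coe _))).le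
  | coe c =>
    induction c with
    | top => exact le_top
    | coe m =>
      exact ENat.WithBot.lt_add_one_iff.1 (h (m + 1) (ENat.WithBot.lt_add_one_iff.2 le_rfl))

theorem globalDim_le {c : WithBot ℕ∞} (h : ∀ n : ℕ, c < n → ∀ (M : Type u) [AddCommGroup M]
    [Module Rᵐᵒᵖ M] [Module.Finite Rᵐᵒᵖ M], PdLT Rᵐᵒᵖ M n) : globalDim R ≤ c :=
  iSup₂_le fun M _ => WithBot.le_of_forall_natCast_lt fun n hn =>
    projectiveDimension_lt_iff.2 (h n hn M)

end GlobalDimension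

namespace GPQ

open MulOpposite

variable {k : Type u} [Field k] {V : Type u} [Quiver.{u} V] {A : V → Type u}
  [∀ i, Ring (A i)] [∀ i, Algebra k (A i)] [Fintype V]
  {I : ∀ i j : V, Set (Quiver.Path i j →₀ k)} {J : TwoSidedIdeal (GPA k A)}

/-- The corner at a vertex of the inflation of a module is the module itself. -/
def cornerInfl (hJ : GPA.GeneratedBy I J) (j : V) (X : Type u) [AddCommGroup X]
    [Module (A j)ᵐᵒᵖ X] :
    X ≃ₗ[(A j)ᵐᵒᵖ] Corner (φ J j) (Infl (coneData hJ j).π.toRingHom X) :=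
  have hπ : ∀ a, (coneData hJ j).π.toRingHom (φ J j a) = a := fun a =>
    congrArg op (π_ι hJ j a.unop)
  { toFun := fun x => ⟨Infl.mk _ x, (Infl.smul_mk _ _ _).trans (by rw [hπ, one_smul])⟩
    invFun := fun x => (Infl.mk _).symm x.1
    left_inv := fun _ => rfl
    right_inv := fun _ => Subtype.ext rfl
    map_add' := fun _ _ => rfl
    map_smul' := fun a x => Subtype.ext ((congrArg (fun b => Infl.mk
      (coneData hJ j).π.toRingHom (b • x)) (hπ a)).symm.trans (Infl.smul_mk _ _ _).symm) }

/-- An `A j`-module is the corner of its own inflation, and taking corners does not raise projective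
dimension. -/
theorem globalDim_vertex_le (hJ : GPA.GeneratedBy I J) (j : V) :
    globalDim (A j) ≤ globalDim (GPQ J) := by
  refine globalDim_le fun n hn X _ _ _ => ?_
  have hsurj : Function.Surjective (coneData hJ j).π.toRingHom := fun a => by
    obtain ⟨v, hv⟩ := π_surjective hJ j a.unop
    exact ⟨op v, congrArg op hv⟩
  have := Infl.finite (coneData hJ j).π.toRingHom hsurj (X := X)
  have h : PdLT (GPQ J)ᵐᵒᵖ (Infl (coneData hJ j).π.toRingHom X) n := pdLT_of_globalDim_lt hn
  have := corner_projective j hJ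
  exact PdLT.of_equiv (cornerInfl hJ j X) (Corner.pdLT (φ J j) h)

theorem globalDim_le_max (hJ : GPA.GeneratedBy I J)
    (hV : ∀ (i : V) (p : Quiver.Path i i), p.length = 0) [∀ i, Module.Finite k (A i)]
    [Module.Finite k (GPQ J)] (hI : relationIdeal k I ≤ arrowIdealPow k V 2)
    (hrel : RelationStartCondition I) :
    globalDim (GPQ J) ≤ max (globalDim (BoundPathAlgebra k I)) (⨆ j : V, globalDim (A j)) := by
  refine globalDim_le fun n hn M _ _ _ => pdLT_of_corners hJ hV M fun j => ?_
  obtain ⟨hB, hA⟩ := max_lt_iff.1 hn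
  have := corner_finite j hJ
  have : Module.Finite (A j)ᵐᵒᵖ (Corner (φ J j) M) := Corner.finite (φ J j)
  have hX : PdLT (A j)ᵐᵒᵖ (Corner (φ J j) M) n :=
    pdLT_of_globalDim_lt ((le_iSup (fun j => globalDim (A j)) j).trans_lt hA)
  match n with
  -- The bound `0` means that all these global dimensions are `⊥`, so every corner of `M` is zero.
  | 0 =>
    have := PdLT.zero_iff.1 hX
    exact PdLT.of_subsingleton
  | n + 1 =>
    refine pdLT_infl hJ j _ hX (pdLT_arrowModule hJ hV
      (fun i n => PdLT (BoundPathAlgebra k I)ᵐᵒᵖ (VertexSimple I i) n) (fun i h => ?_)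
      (fun i m β h => ?_) (fun i hi j hj n h => ?_) j n ?_)
    · exact vertexSimple_not_subsingleton (relationIdeal_generatedBy hI) i (PdLT.zero_iff.1 h)
    · exact vertexSimple_not_projective hI β (PdLT.one_iff.1 h)
    · obtain ⟨p, hp⟩ := hj
      have h1 := (hrel i hi j p hp).trans_lt (rightProjDim_lt_iff.2 h)
      -- From `pd S_j + 1 < n + 1` the bound `pd S_j < n` follows by contraposition, which needs no
      -- cancellation in `WithBot ℕ∞`.
      refine rightProjDim_lt_iff.1 (not_le.1 fun h2 => h1.not_ge ?_)
      exact_mod_cast add_le_add_left h2 1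
    · have := vertexSimple_finite (I := I) j
      exact pdLT_of_globalDim_lt hB

end GPQ

end

end

theorem mainTheorem3 {k : Type u} [Field k] [IsAlgClosed k]
    {V : Type u} [Fintype V] [Quiver.{u} V] [∀ i j : V, Finite (i ⟶ j)]
    (hacyclic : ∀ (i : V) (p : Quiver.Path i i), p.length = 0)
    (A : V → Type u) [∀ i, Ring (A i)] [∀ i, Algebra k (A i)]
    (P : ∀ i, BoundQuiverPresentation k (A i))
    (I : ∀ i j : V, Set (Quiver.Path i j →₀ k))
    (hadm : IsAdmissible (relationIdeal k I))
    (hI : RelationStartCondition I) :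
    (∀ j : V, globalDim (A j) ≤ globalDim (GBPAlgebra P I)) ∧
      globalDim (GBPAlgebra P I) ≤
        max (globalDim (BoundPathAlgebra k I)) (⨆ j : V, globalDim (A j)) := by
  have hJ := gbpIdeal_generatedBy P hadm.2
  have hA : ∀ i, Module.Finite k (A i) := fun i => (P i).finite
  have hG : Module.Finite k (GPA k A) := GPA.finite_of_acyclic hacyclic
  have hQ : Module.Finite k (GPQ (gbpIdeal P I)) :=
    Module.Finite.of_surjective (GPQ.mk (gbpIdeal P I)).toLinearMap (GPQ.mk_surjective _)
  exact ⟨fun j => GPQ.globalDim_vertex_le hJ j, GPQ.globalDim_le_max hJ hacyclic hadm.2 hI⟩
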